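/- Let $\mathcal V$ be a finite set of sites, each carrying a finite-dimensional nonzero complex Hilbert space $\mathcal H_x$, and let $\mathcal H=\bigotimes_{x\in\mathcal V}\mathcal H_x$. Let $\mathcal E$ be a finite set of subsets of $\mathcal V$ (the edges), and let $\hat H=\sum_{X\in\mathcal E}\hat H_X$, where each $\hat H_X$ is self-adjoint and supported in $X$ (it acts as the identity outside $X$). For sites $x\ne y$ let $d(x,y)$ be the least length $d$ of a sequence $X_1,\dots,X_d\in\mathcal E$ with $x\in X_1$, $y\in X_d$, $X_i\cap X_{i+1}\neq\emptyset$ ($d(x,y)=\infty$ if there is none), and $d(x,x)=0$; put $d(x,Y)=\min_{y\in Y}d(x,y)$ and $d(X,Y)=\min_{x\in X}d(x,Y)$ (a minimum over the empty set is $\infty$). For $X\subseteq\mathcal V$ let $X_\partial$ be the set of edges meeting both $X$ and $\mathcal V\setminus X$. Put $J=\max_{X\in\mathcal E}\|\hat H_X\|_\infty$, $N=\max_{X\in\mathcal E}|X|$, $N_\partial=\max_{X\in\mathcal E}|X_\partial|$, and assume $N_\partial\ge1$, i.e. some two distinct edges intersect. Let $M>0$ be such that $|\{Y\in\mathcal E:d(x,Y)=n\}|\le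 M(n+1)^2$ for all $x\in\mathcal V$ and all integers $n\ge0$. For $\beta\in\mathbb R$ let $\hat\omega(\beta)=e^{-\beta\hat H}/\mathrm{Tr}\,e^{-\beta\hat H}$, $\langle\hat O\rangle_\beta=\mathrm{Tr}[\hat O\,\hat\omega(\beta)]$ and $\mathrm{Var}_\beta\hat O=\langle\hat O^2\rangle_\beta-\langle\hat O\rangle_\beta^2$. Let $\xi=\xi(\beta)>0$ be a correlation length at $\beta$: for all disjoint $X,Y\subseteq\mathcal V$ and all self-adjoint $\hat O_X,\hat O_Y$ supported in $X$ and $Y$ respectively, $$\left|\langle\hat O_X\hat O_Y\rangle_\beta-\langle\hat O_X\rangle_\beta\langle\hat O_Y\rangle_\beta\right|\le4(\xi+1)\min(|X_\partial|,|Y_\partial|)\,\|\hat O_X\|_\infty\|\hat O_Y\|_\infty\,e^{-d(X,Y)/\xi}$$ (with $e^{-\infty}=0$). Let $A\subseteq\mathcal V$, let $\mathcal A=\{X\in\mathcal E:X\subseteq A\}$, $\hat H_A=\sum_{X\in\mathcal A}\hat H_X$ and, for $R\in\mathbb N$, $\mathcal C_R=\{X\in\mathcal E\setminus\mathcal A:d(X,A)<R\}$.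 Let $\hat\rho(\beta)=\mathrm{Tr}_{\mathcal V\setminus A}\hat\omega(\beta)$ be the reduced state of $A$ and $$F(\beta)=\sum_{i,j}\frac{2\left|\langle i|\tfrac{d}{d\beta}\hat\rho(\beta)|j\rangle\right|^2}{p_i+p_j}$$ its quantum Fisher information, where $\{|i\rangle\}$ is an orthonormal basis of eigenvectors of $\hat\rho(\beta)$ with eigenvalues $p_i$. Then for every integer $R\ge2\xi+1$, $$\left|\sqrt{F(\beta)}-\sqrt{\mathrm{Var}_\beta\hat H_A}\right|\le2J\sqrt{2MNN_\partial}\,(\xi+1)^2\sqrt{|\mathcal C_R|}+40JM|A|\sqrt{N_\partial}\,(\xi+1)^{3/2}R^2e^{-R/(2\xi)}.$$ -/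

import Mathlib

/-! Locally interacting quantum systems on a finite lattice. Every site `x` carries the Hilbert
space `ℂ^(ι x)` (a finite orthonormal basis `ι x` is fixed), the global Hilbert space is the tensor
product over the sites, with product basis `∀ x, ι x`, and operators are matrices in that basis. -/

namespace QLattice

open scoped Kronecker

variable {V : Type*} [Fintype V] [DecidableEq V]
  {ι : V → Type*} [∀ x, Fintype (ι x)] [∀ x, DecidableEq (ι x)]

/-- The identification `⨂_{x ∈ V} ℋ_x = (⨂_{x ∈ X} ℋ_x) ⊗ (⨂_{x ∉ X} ℋ_x)` on basis labels. -/
def split (ι : V → Type*) (X : Finset V) :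
    (∀ x, ι x) ≃ (∀ x : {x // x ∈ X}, ι x) × (∀ x : {x // ¬ x ∈ X}, ι x) :=
  Equiv.piEquivPiSubtypeProd (fun x => x ∈ X) ι

/-- The global operator `T ⊗ 𝟙` attached to an operator `T` of the subsystem `X`. -/
def extend (X : Finset V)
    (T : Matrix (∀ x : {x // x ∈ X}, ι x) (∀ x : {x // x ∈ X}, ι x) ℂ) :
    Matrix (∀ x, ι x) (∀ x, ι x) ℂ :=
  (T ⊗ₖ (1 : Matrix (∀ x : {x // ¬ x ∈ X}, ι x) (∀ x : {x // ¬ x ∈ X}, ι x) ℂ)).submatrix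
    (split ι X) (split ι X)

/-- `O` acts like the identity outside `X`. -/
def SupportedIn (O : Matrix (∀ x, ι x) (∀ x, ι x) ℂ) (X : Finset V) : Prop :=
  ∃ T : Matrix (∀ x : {x // x ∈ X}, ι x) (∀ x : {x // x ∈ X}, ι x) ℂ, O = extend X T

/-- The partial trace over the complement of `A`. -/
def partialTrace (A : Finset V) (O : Matrix (∀ x, ι x) (∀ x, ι x) ℂ) :
    Matrix (∀ x : {x // x ∈ A}, ι x) (∀ x : {x // x ∈ A}, ι x) ℂ :=
  Matrix.of fun a a' => ∑ b : (∀ x : {x // ¬ x ∈ A}, ι x),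
    O ((split ι A).symm (a, b)) ((split ι A).symm (a', b))

/-- The operator norm on the Hilbert space `ℂ^n`. -/
noncomputable def opNorm {n : Type*} [Fintype n] [DecidableEq n] (O : Matrix n n ℂ) : NNReal :=
  ‖Matrix.toEuclideanCLM (n := n) (𝕜 := ℂ) O‖₊

/-- The Gibbs state `e^{-βH} / Tr e^{-βH}`. -/
noncomputable def gibbs {n : Type*} [Fintype n] [DecidableEq n] (H : Matrix n n ℂ) (β : ℝ) :
    Matrix n n ℂ :=
  (NormedSpace.exp (-(β : ℂ) • H)).trace⁻¹ • NormedSpace.exp (-(β : ℂ) • H)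

/-- The expectation value `Tr[O ω]`. -/
def expect {n : Type*} [Fintype n] (ω O : Matrix n n ℂ) : ℂ := (O * ω).trace

/-- The variance `Tr[O² ω] - (Tr[O ω])²`; it is real for a state `ω` and an observable `O`. -/
def variance {n : Type*} [Fintype n] (ω O : Matrix n n ℂ) : ℝ :=
  (expect ω (O * O) - expect ω O ^ 2).re

/-- The squared Bures norm `∑_{i,j} 2 |⟨i|O|j⟩|² / (p_i + p_j)`, where `|i⟩` is an orthonormal basis
of eigenvectors of `ρ`, with eigenvalues `p_i`. -/
noncomputable def buresNormSq {n : Type*} [Fintype n] [DecidableEq n] (ρ : Matrix n n ℂ)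
    (hρ : ρ.IsHermitian) (O : Matrix n n ℂ) : ℝ :=
  ∑ i, ∑ j, 2 * ‖inner ℂ (hρ.eigenvectorBasis i)
      (Matrix.toEuclideanCLM (n := n) (𝕜 := ℂ) O (hρ.eigenvectorBasis j))‖ ^ 2
    / (hρ.eigenvalues i + hρ.eigenvalues j)

/-- `e^{-d/ξ}` for a distance `d` that may be infinite. -/
noncomputable def decay (ξ : ℝ) : ℕ∞ → ℝ
  | ⊤ => 0
  | (n : ℕ) => Real.exp (-(n : ℝ) / ξ)

/-- A list of edges `X₁, …, X_d` with `x ∈ X₁`, `y ∈ X_d` and `X_i ∩ X_{i+1} ≠ ∅`. -/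
def Joins (E : Finset (Finset V)) (x y : V) (l : List (Finset V)) : Prop :=
  (∀ X ∈ l, X ∈ E) ∧ l.IsChain (fun X Y => (X ∩ Y).Nonempty) ∧
    (∃ X ∈ l.head?, x ∈ X) ∧ (∃ Y ∈ l.getLast?, y ∈ Y)

/-- The distance `d(x, y)` of two sites; `d(x, x) = 0`, and `d(x, y) = ⊤` if no chain of edges
joins `x` to `y`. -/
noncomputable def dist (E : Finset (Finset V)) (x y : V) : ℕ∞ :=
  if x = y then 0 else ⨅ (l : List (Finset V)) (_ : Joins E x y l), (l.length : ℕ∞)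

/-- The distance of a site and a subsystem. -/
noncomputable def distSite (E : Finset (Finset V)) (x : V) (Y : Finset V) : ℕ∞ :=
  ⨅ y ∈ Y, dist E x y

/-- The distance of two subsystems. -/
noncomputable def distSet (E : Finset (Finset V)) (X Y : Finset V) : ℕ∞ :=
  ⨅ x ∈ X, distSite E x Y

/-- The boundary edges of a subsystem: those that meet both it and its complement. -/
def boundary (E : Finset (Finset V)) (X : Finset V) : Finset (Finset V) :=
  E.filter fun Y => (Y ∩ X).Nonempty ∧ (Y ∩ Xᶜ).Nonempty

/-- A Hamiltonian `∑_{X ∈ ℰ} H_X` with self-adjoint terms `H_X` supported in the edges `X`. -/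
structure System (V : Type*) [Fintype V] [DecidableEq V]
    (ι : V → Type*) [∀ x, Fintype (ι x)] [∀ x, DecidableEq (ι x)] where
  /-- the set `ℰ` of edges -/
  edges : Finset (Finset V)
  /-- the terms `H_X`, which are used for edges `X` only -/
  term : Finset V → Matrix (∀ x, ι x) (∀ x, ι x) ℂ
  isHermitian : ∀ X ∈ edges, (term X).IsHermitian
  supported : ∀ X ∈ edges, SupportedIn (term X) X

namespace System

variable (S : System V ι)

/-- `H_𝒢 = ∑_{X ∈ 𝒢} H_X`. -/
def partialHam (G : Finset (Finset V)) : Matrix (∀ x, ι x) (∀ x, ι x) ℂ := ∑ X ∈ G, S.term X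

/-- The global Hamiltonian. -/
def ham : Matrix (∀ x, ι x) (∀ x, ι x) ℂ := S.partialHam S.edges

/-- The edges contained in `A`. -/
def innerEdges (A : Finset V) : Finset (Finset V) := S.edges.filter fun X => X ⊆ A

/-- The local Hamiltonian `H_A` of `A`. -/
def localHam (A : Finset V) : Matrix (∀ x, ι x) (∀ x, ι x) ℂ := S.partialHam (S.innerEdges A)

open Classical in
/-- `𝒞_R`: the edges not contained in `A`, at distance less than `R` from `A`. -/
noncomputable def collar (A : Finset V) (R : ℕ) : Finset (Finset V) :=
  (S.edges \ S.innerEdges A).filter fun X => distSet S.edges X A < (R : ℕ∞)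

/-- The interaction strength `J = max_{X ∈ ℰ} ‖H_X‖`. -/
noncomputable def J : ℝ := (S.edges.sup fun X => opNorm (S.term X) : NNReal)

/-- `N_∂ = max_{X ∈ ℰ} |X_∂|`. -/
def Nbd : ℕ := S.edges.sup fun X => (boundary S.edges X).card

/-- `N = max_{X ∈ ℰ} |X|`. -/
def N : ℕ := S.edges.sup fun X => X.card

/-- The global Gibbs state at inverse temperature `β`. -/
noncomputable def state (β : ℝ) : Matrix (∀ x, ι x) (∀ x, ι x) ℂ := gibbs S.ham β

/-- The reduced state of `A`. -/
noncomputable def reduced (A : Finset V) (β : ℝ) :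
    Matrix (∀ x : {x // x ∈ A}, ι x) (∀ x : {x // x ∈ A}, ι x) ℂ :=
  partialTrace A (S.state β)

theorem ham_isHermitian : S.ham.IsHermitian := by
  unfold ham partialHam Matrix.IsHermitian
  rw [Matrix.conjTranspose_sum]
  exact Finset.sum_congr rfl fun X hX => S.isHermitian X hX

theorem state_isHermitian (β : ℝ) : (S.state β).IsHermitian := by
  have h : (NormedSpace.exp (-(β : ℂ) • S.ham)).IsHermitian := by
    apply Matrix.IsHermitian.exp
    unfold Matrix.IsHermitian
    rw [Matrix.conjTranspose_smul, S.ham_isHermitian.eq]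
    simp
  unfold state gibbs Matrix.IsHermitian
  rw [Matrix.conjTranspose_smul, h.eq, star_inv₀, ← Matrix.trace_conjTranspose, h.eq]

theorem reduced_isHermitian (A : Finset V) (β : ℝ) : (S.reduced A β).IsHermitian := by
  ext a a'
  simp only [reduced, partialTrace, Matrix.conjTranspose_apply, Matrix.of_apply, star_sum]
  exact Finset.sum_congr rfl fun b _ => (S.state_isHermitian β).apply _ _

/-- The (entrywise) derivative of the reduced state with respect to the inverse temperature. -/
noncomputable def reducedDeriv (A : Finset V) (β : ℝ) :
    Matrix (∀ x : {x // x ∈ A}, ι x) (∀ x : {x // x ∈ A}, ι x) ℂ :=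
  Matrix.of fun a a' => deriv (fun b : ℝ => S.reduced A b a a') β

/-- The quantum Fisher information of the family of reduced states of `A`, the local quantum
thermal susceptibility. -/
noncomputable def fisher (A : Finset V) (β : ℝ) : ℝ :=
  buresNormSq (S.reduced A β) (S.reduced_isHermitian A β) (S.reducedDeriv A β)

/-- `ξ` is a correlation length at inverse temperature `β`: the correlations between observables of
any two disjoint subsystems decay exponentially in their distance. -/
def IsCorrelationLength (β ξ : ℝ) : Prop :=
  0 < ξ ∧ ∀ X Y : Finset V, Disjoint X Y →
    ∀ OX OY : Matrix (∀ x, ι x) (∀ x, ι x) ℂ, OX.IsHermitian → OY.IsHermitian →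
      SupportedIn OX X → SupportedIn OY Y →
      ‖expect (S.state β) (OX * OY) - expect (S.state β) OX * expect (S.state β) OY‖ ≤
        4 * (ξ + 1) * (min (boundary S.edges X).card (boundary S.edges Y).card : ℕ)
          * opNorm OX * opNorm OY * decay ξ (distSet S.edges X Y)

/-- At most `M (n + 1)²` edges are at distance `n` from any given site. -/
def GrowthBound (M : ℝ) : Prop :=
  0 < M ∧ ∀ (x : V) (n : ℕ),
    (({Y | Y ∈ S.edges ∧ distSite S.edges x Y = (n : ℕ∞)} : Set (Finset V)).ncard : ℝ)
      ≤ M * ((n : ℝ) + 1) ^ 2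

end System

end QLattice

/-! Write `ω` for the Gibbs state, `ρ` for its restriction to `A` and `{·, ·}` for the
anticommutator. As `ω` commutes with `H`, the derivative of `ρ` is `-Tr_{Aᶜ} ½ {H - ⟨H⟩, ω}`. A
positive definite `ρ` allows to write every Hermitian operator of `A` as `½ {L, ρ}` with a
Hermitian `L`, its symmetric logarithmic derivative, and the squared Bures norm is then `Tr[L² ρ]`,
a squared norm in the GNS space of `ρ` (`exists_gns`, `exists_symMul_eq`, `buresNormSq_symMul`).

Split `H` into `H_A`, the terms of the collar, and the terms far from `A`; the logarithmic
derivatives add up accordingly. As `H_A` acts on `A` only, its part is `H_A - ⟨H_A⟩`, whose squared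
norm is the variance of `H_A`. By the triangle inequality it remains to bound the other two parts.

The Bures norm decreases under the partial trace (`exists_reduced_sld`), so the collar contributes
at most the square root of the variance of its terms. That variance is a double sum of
correlations; clustering and the growth bound make it proportional to the number of terms
(`System.variance_partialHam_le`).

A term `H_Y` with `Y` disjoint from `A` has a logarithmic derivative `T` with `‖T‖ ≤ ‖H_Y‖`, because
an eigenvalue of `T` is an expectation value of `H_Y` in a state obtained from `ω` by a projection
in `A` (`opNorm_sld_le`). The squared norm of its contribution is exactly the correlation of `T`
with `H_Y` (`exists_sld_of_disjoint`), so the contribution decays like `e^{-d(A, Y) / (2 ξ)}`.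
Summing over shells around the sites of `A` gives the last term of the bound
(`System.GrowthBound.sum_decay_far_le`). -/

set_option linter.unusedSectionVars false

namespace QLattice

open Matrix
open scoped ComplexOrder Kronecker

/-! ### The GNS space of a state -/

section States

variable {n : Type*} [Fintype n]

theorem expect_add (ω X Y : Matrix n n ℂ) : expect ω (X + Y) = expect ω X + expect ω Y := by
  simp [expect, Matrix.add_mul, trace_add]

theorem expect_smul (ω : Matrix n n ℂ) (c : ℂ) (X : Matrix n n ℂ) :
    expect ω (c • X) = c * expect ω X := by
  simp [expect]

theorem expect_sum {κ : Type*} (ω : Matrix n n ℂ) (s : Finset κ) (X : κ → Matrix n n ℂ) :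
    expect ω (∑ i ∈ s, X i) = ∑ i ∈ s, expect ω (X i) := by
  simp [expect, Matrix.sum_mul, trace_sum]

theorem star_expect {ω : Matrix n n ℂ} (hω : ω.IsHermitian) (X : Matrix n n ℂ) :
    star (expect ω X) = expect ω Xᴴ := by
  rw [expect, ← trace_conjTranspose, conjTranspose_mul, hω.eq, trace_mul_comm, expect]

theorem expect_eq_re {ω : Matrix n n ℂ} (hω : ω.IsHermitian) {X : Matrix n n ℂ}
    (hX : X.IsHermitian) : expect ω X = ((expect ω X).re : ℂ) := by
  have h := star_expect hω X
  rw [hX.eq] at h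
  exact (Complex.conj_eq_iff_re.1 h).symm

variable [DecidableEq n]

theorem sum_norm_sq_mulVec_le (H : Matrix n n ℂ) (x : n → ℂ) :
    ∑ i, ‖(H *ᵥ x) i‖ ^ 2 ≤ (opNorm H : ℝ) ^ 2 * ∑ i, ‖x i‖ ^ 2 := by
  have h := (Matrix.toEuclideanCLM (n := n) (𝕜 := ℂ) H).le_opNorm (WithLp.toLp 2 x)
  have h2 := pow_le_pow_left₀ (norm_nonneg _) h 2
  rw [mul_pow, EuclideanSpace.norm_sq_eq, EuclideanSpace.norm_sq_eq] at h2
  simpa [opNorm] using h2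

theorem opNorm_le_of_sum_norm_sq_le (H : Matrix n n ℂ) {c : ℝ} (hc : 0 ≤ c)
    (h : ∀ x : n → ℂ, ∑ i, ‖(H *ᵥ x) i‖ ^ 2 ≤ c ^ 2 * ∑ i, ‖x i‖ ^ 2) :
    (opNorm H : ℝ) ≤ c := by
  refine ContinuousLinearMap.opNorm_le_bound _ hc fun x => ?_
  refine le_of_sq_le_sq ?_ (by positivity)
  rw [mul_pow, EuclideanSpace.norm_sq_eq, EuclideanSpace.norm_sq_eq]
  simpa using h x.ofLp

open scoped MatrixOrder Matrix.Norms.L2Operator in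
/-- The GNS representation of a state: a linear map of the operators to a Hilbert space, with
`⟨Φ X, Φ Y⟩ = Tr[X† Y ω]`. For `ω = B B†` the operator `X B`, read as a vector, will do.
Left multiplication is bounded by the operator norm. -/
theorem exists_gns {ω : Matrix n n ℂ} (hω : ω.PosSemidef) :
    ∃ Φ : Matrix n n ℂ →ₗ[ℂ] EuclideanSpace ℂ (n × n),
      (∀ X Y, inner ℂ (Φ X) (Φ Y) = expect ω (Xᴴ * Y)) ∧
      ∀ H X, ‖Φ (H * X)‖ ≤ opNorm H * ‖Φ X‖ := by
  obtain ⟨B, rfl⟩ : ∃ B, ω = B * Bᴴ := by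
    obtain ⟨B, hB⟩ := CStarAlgebra.nonneg_iff_eq_star_mul_self.1 hω.nonneg
    exact ⟨Bᴴ, by rw [hB, conjTranspose_conjTranspose]; rfl⟩
  refine ⟨{ toFun := fun X => WithLp.toLp 2 fun p => (X * B) p.1 p.2
            map_add' := ?_, map_smul' := ?_ }, ?_, ?_⟩
  · intro X Y; ext p; simp [Matrix.add_mul]
  · intro c X; ext p; simp
  · intro X Y
    simp only [LinearMap.coe_mk, AddHom.coe_mk, expect, PiLp.inner_apply, RCLike.inner_apply]
    rw [← Matrix.mul_assoc, Matrix.trace_mul_comm, ← Matrix.mul_assoc, ← Matrix.mul_assoc,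
      ← conjTranspose_mul, Matrix.mul_assoc, Fintype.sum_prod_type, Finset.sum_comm]
    simp only [trace, diag_apply, Matrix.mul_apply (M := (X * B)ᴴ), conjTranspose_apply]
    refine Finset.sum_congr rfl fun i _ => Finset.sum_congr rfl fun j _ => ?_
    rw [mul_comm]; rfl
  · intro H X
    refine le_of_sq_le_sq ?_ (by positivity)
    rw [mul_pow, EuclideanSpace.norm_sq_eq, EuclideanSpace.norm_sq_eq]
    simp only [LinearMap.coe_mk, AddHom.coe_mk]
    rw [Fintype.sum_prod_type_right, Fintype.sum_prod_type_right, Finset.mul_sum]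
    refine Finset.sum_le_sum fun j _ => ?_
    have h := sum_norm_sq_mulVec_le H fun i => (X * B) i j
    rw [Matrix.mul_assoc]
    exact h

/-- A state gives expectation values bounded by the operator norm. -/
theorem norm_expect_le {ω : Matrix n n ℂ} (hω : ω.PosSemidef) (hω1 : ω.trace = 1)
    (X : Matrix n n ℂ) : ‖expect ω X‖ ≤ opNorm X := by
  obtain ⟨Φ, hΦ, hΦ'⟩ := exists_gns hω
  have h1 : ‖Φ 1‖ = 1 := by
    have : ((‖Φ 1‖ ^ 2 : ℝ) : ℂ) = 1 := by
      have := hΦ 1 1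
      rw [inner_self_eq_norm_sq_to_K] at this
      rw [Complex.ofReal_pow]
      simpa [expect, hω1] using this
    have h : ‖Φ 1‖ ^ 2 = 1 := by exact_mod_cast this
    nlinarith [norm_nonneg (Φ 1)]
  have h2 : expect ω X = inner ℂ (Φ 1) (Φ (X * 1)) := by rw [hΦ]; simp
  rw [h2]
  refine (norm_inner_le_norm _ _).trans ?_
  have := hΦ' X 1
  rw [h1] at *
  linarith

end States

/-! ### Symmetric logarithmic derivatives and the Bures norm -/

section Fisher

variable {n : Type*} [Fintype n]

/-- The symmetrized product `½ (L ρ + ρ L)`; `L` is the symmetric logarithmic derivative of this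
operator at `ρ`. -/
noncomputable def symMul (ρ L : Matrix n n ℂ) : Matrix n n ℂ := (1 / 2 : ℂ) • (L * ρ + ρ * L)

theorem symMul_add (ρ L L' : Matrix n n ℂ) : symMul ρ (L + L') = symMul ρ L + symMul ρ L' := by
  simp only [symMul, Matrix.add_mul, Matrix.mul_add, ← smul_add]
  congr 1; abel

theorem symMul_sum {κ : Type*} (ρ : Matrix n n ℂ) (s : Finset κ) (L : κ → Matrix n n ℂ) :
    symMul ρ (∑ i ∈ s, L i) = ∑ i ∈ s, symMul ρ (L i) := by
  simp only [symMul, Matrix.sum_mul, Matrix.mul_sum, ← Finset.smul_sum, Finset.sum_add_distrib]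

theorem symMul_smul (ρ : Matrix n n ℂ) (c : ℂ) (L : Matrix n n ℂ) :
    symMul ρ (c • L) = c • symMul ρ L := by
  simp only [symMul, Matrix.smul_mul, Matrix.mul_smul, ← smul_add]
  rw [smul_comm]

theorem symMul_isHermitian {ρ L : Matrix n n ℂ} (hρ : ρ.IsHermitian) (hL : L.IsHermitian) :
    (symMul ρ L).IsHermitian := by
  unfold symMul Matrix.IsHermitian
  rw [conjTranspose_smul, conjTranspose_add, conjTranspose_mul, conjTranspose_mul, hρ.eq, hL.eq,
    add_comm]
  simp

/-- Pairing a Hermitian `T` with `symMul ρ L` computes the symmetrized correlation of `T`, `L`. -/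
theorem trace_mul_symMul {ρ T L : Matrix n n ℂ} (hρ : ρ.IsHermitian) (hT : T.IsHermitian)
    (hL : L.IsHermitian) : (T * symMul ρ L).trace = ((expect ρ (T * L)).re : ℂ) := by
  have h1 : star (expect ρ (T * L)) = (T * (ρ * L)).trace := by
    rw [star_expect hρ, conjTranspose_mul, hT.eq, hL.eq, expect, ← Matrix.mul_assoc,
      Matrix.trace_mul_comm, Matrix.mul_assoc, Matrix.trace_mul_comm, Matrix.mul_assoc,
      Matrix.trace_mul_comm, Matrix.mul_assoc]
  rw [symMul, Matrix.mul_smul, Matrix.mul_add, trace_smul, trace_add, ← h1, ← Matrix.mul_assoc]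
  change (1 / 2 : ℂ) • (expect ρ (T * L) + (starRingEnd ℂ) (expect ρ (T * L))) = _
  rw [Complex.add_conj]
  simp

variable [DecidableEq n]

theorem symMul_one (ρ : Matrix n n ℂ) : symMul ρ 1 = ρ := by
  rw [symMul, Matrix.one_mul, Matrix.mul_one, ← two_smul ℂ ρ, smul_smul]; norm_num

/-- The squared Bures norm of `½ (L ρ + ρ L)` is `Tr[L² ρ]`. -/
theorem buresNormSq_symMul {ρ L : Matrix n n ℂ} (hρ : ρ.PosDef) (h : ρ.IsHermitian)
    (hL : L.IsHermitian) : buresNormSq ρ h (symMul ρ L) = (expect ρ (L * L)).re := by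
  set e := h.eigenvectorBasis with he
  set p := h.eigenvalues with hp
  have hpos : ∀ i, 0 < p i := fun i => hρ.eigenvalues_pos i
  set T := Matrix.toEuclideanCLM (n := n) (𝕜 := ℂ) with hT
  have hρe : ∀ j, T ρ (e j) = (p j : ℂ) • e j := by
    intro j
    apply (WithLp.ofLp_injective 2)
    rw [hT, Matrix.ofLp_toEuclideanCLM, h.mulVec_eigenvectorBasis j]
    rfl
  have hsym : ∀ X : Matrix n n ℂ, X.IsHermitian → ∀ x y, inner ℂ (T X x) y = inner ℂ x (T X y) := by
    intro X hX x y
    have h1 : star (T X) = T X := by rw [← map_star, star_eq_conjTranspose, hX.eq]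
    rw [ContinuousLinearMap.star_eq_adjoint] at h1
    rw [← ContinuousLinearMap.adjoint_inner_right, h1]
  have helt : ∀ i j, inner ℂ (e i) (T (symMul ρ L) (e j)) =
      ((p i + p j) / 2 : ℝ) * inner ℂ (e i) (T L (e j)) := by
    intro i j
    have : T (symMul ρ L) (e j) =
        (1 / 2 : ℂ) • (T L (T ρ (e j)) + T ρ (T L (e j))) := by
      rw [symMul, map_smul, map_add, map_mul, map_mul]; rfl
    rw [this, inner_smul_right, inner_add_right, ← hsym ρ h, hρe, hρe, map_smul, inner_smul_right,
      inner_smul_left]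
    push_cast
    rw [Complex.conj_ofReal]; ring
  have hswap : ∀ i j, ‖inner ℂ (e i) (T L (e j))‖ = ‖inner ℂ (e j) (T L (e i))‖ := by
    intro i j
    rw [← hsym L hL, ← inner_conj_symm, RCLike.norm_conj]
  -- the weights `2 / (p i + p j)` and `((p i + p j) / 2) ^ 2` leave `(p i + p j) / 2`, and the two
  -- halves agree by the symmetry of `|⟨i|L|j⟩|`
  have hterm : ∀ i j, 2 * ‖inner ℂ (e i) (T (symMul ρ L) (e j))‖ ^ 2 / (p i + p j) =
      (p i * ‖inner ℂ (e j) (T L (e i))‖ ^ 2 + p j * ‖inner ℂ (e i) (T L (e j))‖ ^ 2) / 2 := by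
    intro i j
    have := hpos i
    have := hpos j
    rw [helt, norm_mul, Complex.norm_real, Real.norm_of_nonneg (by positivity), hswap j i]
    field_simp
  have hsum : ∀ j, ∑ i, p j * ‖inner ℂ (e i) (T L (e j))‖ ^ 2 = p j * ‖T L (e j)‖ ^ 2 := by
    intro j
    rw [← Finset.mul_sum, e.sum_sq_norm_inner_right]
  have htr : expect ρ (L * L) = ∑ j, ((p j * ‖T L (e j)‖ ^ 2 : ℝ) : ℂ) := by
    have h1 : expect ρ (L * L) =
        LinearMap.trace ℂ _ (T (L * L * ρ) : EuclideanSpace ℂ n →ₗ[ℂ] _) := by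
      rw [LinearMap.trace_eq_sum_inner _ (EuclideanSpace.basisFun n ℂ)]
      simp [expect, trace, hT, EuclideanSpace.inner_single_left]
      rfl
    rw [h1, LinearMap.trace_eq_sum_inner _ e]
    refine Finset.sum_congr rfl fun j _ => ?_
    have : (T (L * L * ρ)) (e j) = T L (T L (T ρ (e j))) := by
      rw [map_mul, map_mul]; rfl
    rw [ContinuousLinearMap.coe_coe, this, hρe, map_smul, map_smul, inner_smul_right, ← hsym L hL,
      inner_self_eq_norm_sq_to_K]
    push_cast
    rfl
  rw [htr, ← Complex.ofReal_sum, Complex.ofReal_re]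
  unfold buresNormSq
  simp only [← he, ← hp, ← hT, hterm, ← Finset.sum_div, Finset.sum_add_distrib]
  rw [Finset.sum_comm (f := fun i j => p j * ‖inner ℂ (e i) (T L (e j))‖ ^ 2)]
  simp only [hsum]
  ring

/-- At a positive definite `ρ` every Hermitian operator has a Hermitian symmetric logarithmic
derivative: divide its entries in an eigenbasis of `ρ` by `(p i + p j) / 2`. -/
theorem exists_symMul_eq {ρ O : Matrix n n ℂ} (hρ : ρ.PosDef) (hO : O.IsHermitian) :
    ∃ L : Matrix n n ℂ, L.IsHermitian ∧ symMul ρ L = O := by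
  have h := hρ.isHermitian
  set p := h.eigenvalues
  have hpos : ∀ i, 0 < p i := fun i => hρ.eigenvalues_pos i
  set U : Matrix n n ℂ := h.eigenvectorUnitary.1 with hU
  have hUU : Uᴴ * U = 1 := Unitary.coe_star_mul_self h.eigenvectorUnitary
  have hUU' : U * Uᴴ = 1 := Unitary.coe_mul_star_self h.eigenvectorUnitary
  have hspec : ρ = U * diagonal (fun i => (p i : ℂ)) * Uᴴ := by
    have := h.spectral_theorem
    rw [Unitary.conjStarAlgAut_apply] at this
    exact this
  set O' := Uᴴ * O * U with hO'
  have hO'h : O'ᴴ = O' := by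
    rw [hO', conjTranspose_mul, conjTranspose_mul, conjTranspose_conjTranspose, hO.eq,
      Matrix.mul_assoc]
  set L' : Matrix n n ℂ := Matrix.of fun i j => 2 * O' i j / ((p i : ℂ) + p j) with hL'
  have hL'h : L'ᴴ = L' := by
    ext i j
    have : star (O' j i) = O' i j := by rw [← conjTranspose_apply, hO'h]
    simp only [hL', conjTranspose_apply, of_apply, star_div₀, star_mul', this, star_add]
    simp [add_comm]
  have hkey : L' * diagonal (fun i => (p i : ℂ)) + diagonal (fun i => (p i : ℂ)) * L' =
      (2 : ℂ) • O' := by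
    ext i j
    have : (p i : ℂ) + p j ≠ 0 := by
      have := add_pos (hpos i) (hpos j)
      exact_mod_cast this.ne'
    simp only [Matrix.add_apply, mul_diagonal, diagonal_mul, hL', of_apply, Matrix.smul_apply,
      smul_eq_mul]
    field_simp
    ring
  refine ⟨U * L' * Uᴴ, ?_, ?_⟩
  · unfold Matrix.IsHermitian
    rw [conjTranspose_mul, conjTranspose_mul, conjTranspose_conjTranspose, hL'h, Matrix.mul_assoc]
  · have e1 : U * L' * Uᴴ * ρ = U * (L' * diagonal (fun i => (p i : ℂ))) * Uᴴ := by
      rw [hspec]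
      calc _ = U * L' * (Uᴴ * U) * diagonal (fun i => (p i : ℂ)) * Uᴴ := by
            simp only [Matrix.mul_assoc]
        _ = _ := by rw [hUU]; simp only [Matrix.mul_assoc, Matrix.mul_one]
    have e2 : ρ * (U * L' * Uᴴ) = U * (diagonal (fun i => (p i : ℂ)) * L') * Uᴴ := by
      rw [hspec]
      calc _ = U * diagonal (fun i => (p i : ℂ)) * (Uᴴ * U) * L' * Uᴴ := by
            simp only [Matrix.mul_assoc]
        _ = _ := by rw [hUU]; simp only [Matrix.mul_assoc, Matrix.mul_one]
    rw [symMul, e1, e2, ← Matrix.add_mul, ← Matrix.mul_add, hkey, hO']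
    calc _ = (1 / 2 * 2 : ℂ) • ((U * Uᴴ) * O * (U * Uᴴ)) := by
          rw [mul_smul]
          simp only [Matrix.mul_smul, Matrix.smul_mul, Matrix.mul_assoc]
      _ = O := by rw [hUU']; simp

/-- A Hermitian matrix is bounded by `c` if all its eigenvalues are. -/
theorem opNorm_le_of_eigenvalues {L : Matrix n n ℂ} (hL : L.IsHermitian) {c : ℝ} (hc : 0 ≤ c)
    (h : ∀ (v : EuclideanSpace ℂ n) (l : ℝ), ‖v‖ = 1 → L *ᵥ v.ofLp = (l : ℂ) • v.ofLp → |l| ≤ c) :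
    (opNorm L : ℝ) ≤ c := by
  set e := hL.eigenvectorBasis with he
  set p := hL.eigenvalues with hp
  have hpe : ∀ j, L *ᵥ (e j).ofLp = (p j : ℂ) • (e j).ofLp := by
    intro j
    rw [hL.mulVec_eigenvectorBasis j]
    rfl
  have hpc : ∀ j, |p j| ≤ c := fun j => h (e j) (p j) (e.norm_eq_one j) (hpe j)
  refine ContinuousLinearMap.opNorm_le_bound _ hc fun x => ?_
  refine le_of_sq_le_sq ?_ (by positivity)
  rw [mul_pow, ← e.sum_sq_norm_inner_right, ← e.sum_sq_norm_inner_right x, Finset.mul_sum]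
  refine Finset.sum_le_sum fun i _ => ?_
  have h1 : star (Matrix.toEuclideanCLM (n := n) (𝕜 := ℂ) L) =
      Matrix.toEuclideanCLM (n := n) (𝕜 := ℂ) L := by
    rw [← map_star, star_eq_conjTranspose, hL.eq]
  rw [ContinuousLinearMap.star_eq_adjoint] at h1
  have h2 : Matrix.toEuclideanCLM (n := n) (𝕜 := ℂ) L (e i) = (p i : ℂ) • e i := by
    apply (WithLp.ofLp_injective 2)
    rw [Matrix.ofLp_toEuclideanCLM, hpe]
    rfl
  rw [← h1, ContinuousLinearMap.adjoint_inner_right, h2, inner_smul_left, norm_mul, mul_pow,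
    Complex.conj_ofReal, Complex.norm_real]
  have := pow_le_pow_left₀ (abs_nonneg _) (hpc i) 2
  rw [Real.norm_eq_abs]
  gcongr

end Fisher

/-! ### Supports and partial traces -/

section Subsystems

variable {V : Type*} [Fintype V] [DecidableEq V]
  {ι : V → Type*} [∀ x, Fintype (ι x)] [∀ x, DecidableEq (ι x)]

theorem extend_apply (X : Finset V)
    (T : Matrix (∀ x : {x // x ∈ X}, ι x) (∀ x : {x // x ∈ X}, ι x) ℂ) (i j : ∀ x, ι x) :
    extend X T i j =
      if ∀ x, x ∉ X → i x = j x then T (fun x => i x) (fun x => j x) else 0 := by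
  simp only [extend, submatrix_apply, kroneckerMap_apply, one_apply, split,
    Equiv.piEquivPiSubtypeProd_apply, mul_ite, mul_one, mul_zero, funext_iff, Subtype.forall]

theorem extend_mul (X : Finset V)
    (T T' : Matrix (∀ x : {x // x ∈ X}, ι x) (∀ x : {x // x ∈ X}, ι x) ℂ) :
    extend X (T * T') = extend X T * extend X T' := by
  rw [extend, extend, extend, submatrix_mul_equiv, ← mul_kronecker_mul, Matrix.mul_one]

theorem extend_add (X : Finset V)
    (T T' : Matrix (∀ x : {x // x ∈ X}, ι x) (∀ x : {x // x ∈ X}, ι x) ℂ) :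
    extend X (T + T') = extend X T + extend X T' := by
  rw [extend, extend, extend, add_kronecker]; rfl

theorem extend_smul (X : Finset V) (c : ℂ)
    (T : Matrix (∀ x : {x // x ∈ X}, ι x) (∀ x : {x // x ∈ X}, ι x) ℂ) :
    extend X (c • T) = c • extend X T := by
  rw [extend, extend, smul_kronecker]; rfl

theorem extend_zero (X : Finset V) : extend (ι := ι) X 0 = 0 := by
  ext i j; simp [extend_apply]

theorem extend_one (X : Finset V) : extend (ι := ι) X 1 = 1 := by
  rw [extend, one_kronecker_one, submatrix_one_equiv]

theorem extend_conjTranspose (X : Finset V)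
    (T : Matrix (∀ x : {x // x ∈ X}, ι x) (∀ x : {x // x ∈ X}, ι x) ℂ) :
    extend X Tᴴ = (extend X T)ᴴ := by
  rw [extend, extend, conjTranspose_submatrix, conjTranspose_kronecker, conjTranspose_one]

theorem isHermitian_extend {X : Finset V}
    {T : Matrix (∀ x : {x // x ∈ X}, ι x) (∀ x : {x // x ∈ X}, ι x) ℂ} (hT : T.IsHermitian) :
    (extend X T).IsHermitian := by
  unfold Matrix.IsHermitian
  rw [← extend_conjTranspose, hT.eq]

theorem opNorm_extend_le (X : Finset V)
    (T : Matrix (∀ x : {x // x ∈ X}, ι x) (∀ x : {x // x ∈ X}, ι x) ℂ) :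
    opNorm (extend X T) ≤ opNorm T := by
  refine NNReal.coe_le_coe.1 (opNorm_le_of_sum_norm_sq_le _ (opNorm T).2 fun x => ?_)
  rw [← (split ι X).symm.sum_comp, ← (split ι X).symm.sum_comp, Fintype.sum_prod_type_right,
    Fintype.sum_prod_type_right, Finset.mul_sum]
  refine Finset.sum_le_sum fun b _ => ?_
  have h : ∀ a, (extend X T *ᵥ x) ((split ι X).symm (a, b)) =
      (T *ᵥ fun a => x ((split ι X).symm (a, b))) a := by
    intro a
    rw [mulVec, dotProduct, ← (split ι X).symm.sum_comp, Fintype.sum_prod_type]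
    simp [extend, mulVec, dotProduct, one_apply]
  simp only [h]
  exact sum_norm_sq_mulVec_le T _

theorem SupportedIn.mono {O : Matrix (∀ x, ι x) (∀ x, ι x) ℂ} {X Y : Finset V}
    (hO : SupportedIn O X) (hXY : X ⊆ Y) : SupportedIn O Y := by
  obtain ⟨T, rfl⟩ := hO
  refine ⟨Matrix.of fun a b => if ∀ x : {x // x ∈ Y}, x.1 ∉ X → a x = b x then
      T (fun x => a ⟨x, hXY x.2⟩) (fun x => b ⟨x, hXY x.2⟩) else 0, ?_⟩
  ext i j
  rw [extend_apply, extend_apply, of_apply, ← ite_and]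
  refine if_congr ⟨fun h => ⟨fun x hx => h x fun hx' => hx (hXY hx'), fun x hx => h x hx⟩,
    fun h x hx => ?_⟩ rfl rfl
  by_cases hxY : x ∈ Y
  · exact h.2 ⟨x, hxY⟩ hx
  · exact h.1 x hxY

theorem SupportedIn.sum {κ : Type*} {s : Finset κ} {O : κ → Matrix (∀ x, ι x) (∀ x, ι x) ℂ}
    {X : Finset V} (h : ∀ k ∈ s, SupportedIn (O k) X) : SupportedIn (∑ k ∈ s, O k) X := by
  classical
  induction s using Finset.induction_on with
  | empty => exact ⟨0, by rw [extend_zero, Finset.sum_empty]⟩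
  | insert k s hk ih =>
    obtain ⟨T, hT⟩ := h k (Finset.mem_insert_self k s)
    obtain ⟨T', hT'⟩ := ih fun k hk => h k (Finset.mem_insert_of_mem hk)
    exact ⟨T + T', by rw [Finset.sum_insert hk, extend_add, hT, hT']⟩

/-- The entries of a product of operators with disjoint supports: only one intermediate
configuration contributes. -/
theorem extend_mul_extend_apply {X Y : Finset V} (hXY : Disjoint X Y)
    (T : Matrix (∀ x : {x // x ∈ X}, ι x) (∀ x : {x // x ∈ X}, ι x) ℂ)
    (T' : Matrix (∀ x : {x // x ∈ Y}, ι x) (∀ x : {x // x ∈ Y}, ι x) ℂ) (i k : ∀ x, ι x) :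
    (extend X T * extend Y T') i k =
      if ∀ x, x ∉ X → x ∉ Y → i x = k x then
        T (fun x => i x) (fun x => k x) * T' (fun x => i x) (fun x => k x) else 0 := by
  rw [Matrix.mul_apply, Finset.sum_eq_single fun x => if x ∈ X then k x else i x]
  · have h1 : (fun x : {x // x ∈ X} => if (x : V) ∈ X then k x else i x) =
        fun x : {x // x ∈ X} => k x :=
      funext fun (x : {x // x ∈ X}) => if_pos x.2
    have h2 : (fun x : {x // x ∈ Y} => if (x : V) ∈ X then k x else i x) =
        fun x : {x // x ∈ Y} => i x :=
      funext fun (x : {x // x ∈ Y}) => if_neg fun h => Finset.disjoint_left.1 hXY h x.2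
    rw [extend_apply, extend_apply, if_pos, h1, h2, mul_ite, mul_zero]
    · refine if_congr ⟨fun h x hx hy => ?_, fun h x hy => ?_⟩ rfl rfl
      · simpa [hx] using h x hy
      · by_cases hx : x ∈ X
        · simp [hx]
        · simpa [hx] using h x hx hy
    · intro x hx
      simp [hx]
  · intro j _ hj
    rw [extend_apply, extend_apply]
    by_cases h1 : ∀ x, x ∉ X → i x = j x
    · by_cases h2 : ∀ x, x ∉ Y → j x = k x
      · refine absurd (funext fun x => ?_) hj
        by_cases hx : x ∈ X
        · rw [if_pos hx, h2 x (Finset.disjoint_left.1 hXY hx)]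
        · rw [if_neg hx, h1 x hx]
      · rw [if_neg h2, mul_zero]
    · rw [if_neg h1, zero_mul]
  · exact fun h => absurd (Finset.mem_univ _) h

/-- Operators with disjoint supports commute. -/
theorem commute_of_disjoint {O O' : Matrix (∀ x, ι x) (∀ x, ι x) ℂ} {X Y : Finset V}
    (hXY : Disjoint X Y) (hO : SupportedIn O X) (hO' : SupportedIn O' Y) : O * O' = O' * O := by
  obtain ⟨T, rfl⟩ := hO
  obtain ⟨T', rfl⟩ := hO'
  ext i k
  rw [extend_mul_extend_apply hXY, extend_mul_extend_apply hXY.symm]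
  exact if_congr ⟨fun h x hx hy => h x hy hx, fun h x hx hy => h x hy hx⟩ (mul_comm _ _) rfl

theorem partialTrace_extend_mul (A : Finset V)
    (T : Matrix (∀ x : {x // x ∈ A}, ι x) (∀ x : {x // x ∈ A}, ι x) ℂ)
    (K : Matrix (∀ x, ι x) (∀ x, ι x) ℂ) :
    partialTrace A (extend A T * K) = T * partialTrace A K := by
  have h : ∀ a b j, (extend A T * K) ((split ι A).symm (a, b)) j =
      ∑ c, T a c * K ((split ι A).symm (c, b)) j := by
    intro a b j
    rw [Matrix.mul_apply, ← (split ι A).symm.sum_comp, Fintype.sum_prod_type]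
    simp [extend, one_apply]
  ext a a'
  simp only [partialTrace, of_apply, h, Matrix.mul_apply, Finset.mul_sum]
  exact Finset.sum_comm

theorem partialTrace_mul_extend (A : Finset V)
    (T : Matrix (∀ x : {x // x ∈ A}, ι x) (∀ x : {x // x ∈ A}, ι x) ℂ)
    (K : Matrix (∀ x, ι x) (∀ x, ι x) ℂ) :
    partialTrace A (K * extend A T) = partialTrace A K * T := by
  have h : ∀ a b j, (K * extend A T) j ((split ι A).symm (a, b)) =
      ∑ c, K j ((split ι A).symm (c, b)) * T c a := by
    intro a b j
    rw [Matrix.mul_apply, ← (split ι A).symm.sum_comp, Fintype.sum_prod_type]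
    simp [extend, one_apply]
  ext a a'
  simp only [partialTrace, of_apply, h, Matrix.mul_apply, Finset.sum_mul]
  exact Finset.sum_comm

theorem trace_partialTrace (A : Finset V) (K : Matrix (∀ x, ι x) (∀ x, ι x) ℂ) :
    (partialTrace A K).trace = K.trace := by
  rw [trace, trace, ← (split ι A).symm.sum_comp, Fintype.sum_prod_type]
  rfl

theorem partialTrace_add (A : Finset V) (K K' : Matrix (∀ x, ι x) (∀ x, ι x) ℂ) :
    partialTrace A (K + K') = partialTrace A K + partialTrace A K' := by
  ext a a'; simp [partialTrace, Finset.sum_add_distrib]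

theorem partialTrace_smul (A : Finset V) (c : ℂ) (K : Matrix (∀ x, ι x) (∀ x, ι x) ℂ) :
    partialTrace A (c • K) = c • partialTrace A K := by
  ext a a'; simp [partialTrace, Finset.mul_sum]

theorem partialTrace_sum {κ : Type*} (A : Finset V) (s : Finset κ)
    (K : κ → Matrix (∀ x, ι x) (∀ x, ι x) ℂ) :
    partialTrace A (∑ k ∈ s, K k) = ∑ k ∈ s, partialTrace A (K k) := by
  ext a a'
  simp only [partialTrace, of_apply, Matrix.sum_apply]
  exact Finset.sum_comm

theorem isHermitian_partialTrace (A : Finset V) {K : Matrix (∀ x, ι x) (∀ x, ι x) ℂ}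
    (hK : K.IsHermitian) : (partialTrace A K).IsHermitian := by
  ext a a'
  simp only [partialTrace, conjTranspose_apply, of_apply, star_sum]
  exact Finset.sum_congr rfl fun b _ => hK.apply _ _

theorem posDef_partialTrace [∀ x, Nonempty (ι x)] (A : Finset V)
    {K : Matrix (∀ x, ι x) (∀ x, ι x) ℂ} (hK : K.PosDef) : (partialTrace A K).PosDef := by
  have h : partialTrace A K = ∑ b : (∀ x : {x // ¬ x ∈ A}, ι x),
      K.submatrix (fun a => (split ι A).symm (a, b)) (fun a => (split ι A).symm (a, b)) := by
    ext a a'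
    simp [partialTrace, Matrix.sum_apply]
  rw [h]
  refine posDef_sum Finset.univ_nonempty fun b _ => hK.submatrix fun a a' haa => ?_
  simpa using haa

theorem symMul_extend (A : Finset V)
    (T : Matrix (∀ x : {x // x ∈ A}, ι x) (∀ x : {x // x ∈ A}, ι x) ℂ)
    (ω : Matrix (∀ x, ι x) (∀ x, ι x) ℂ) :
    partialTrace A (symMul ω (extend A T)) = symMul (partialTrace A ω) T := by
  rw [symMul, partialTrace_smul, partialTrace_add, partialTrace_extend_mul,
    partialTrace_mul_extend, symMul]

theorem expect_extend (A : Finset V)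
    (T : Matrix (∀ x : {x // x ∈ A}, ι x) (∀ x : {x // x ∈ A}, ι x) ℂ)
    (ω : Matrix (∀ x, ι x) (∀ x, ι x) ℂ) :
    expect ω (extend A T) = expect (partialTrace A ω) T := by
  rw [expect, ← trace_partialTrace A, partialTrace_extend_mul, expect]

end Subsystems

/-! ### The Gibbs state and its derivative -/

section GibbsState

variable {n : Type*} [Fintype n] [DecidableEq n]

theorem posDef_exp {H : Matrix n n ℂ} (hH : H.IsHermitian) : (NormedSpace.exp H).PosDef := by
  have h1 : NormedSpace.exp H =
      (NormedSpace.exp ((1 / 2 : ℂ) • H))ᴴ * NormedSpace.exp ((1 / 2 : ℂ) • H) := by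
    rw [← Matrix.exp_conjTranspose, conjTranspose_smul, hH.eq,
      show star (1 / 2 : ℂ) = 1 / 2 by simp, ← Matrix.exp_add_of_commute _ _ (Commute.refl _),
      ← add_smul]
    norm_num
  rw [h1]
  exact PosDef.conjTranspose_mul_self _
    (Matrix.mulVec_injective_iff_isUnit.2 (Matrix.isUnit_exp _))

theorem posDef_exp_smul {H : Matrix n n ℂ} (hH : H.IsHermitian) (β : ℝ) :
    (NormedSpace.exp (-(β : ℂ) • H)).PosDef := by
  refine posDef_exp ?_
  unfold Matrix.IsHermitian
  rw [conjTranspose_smul, hH.eq]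
  simp

theorem posDef_gibbs [Nonempty n] {H : Matrix n n ℂ} (hH : H.IsHermitian) (β : ℝ) :
    (gibbs H β).PosDef := by
  have h := posDef_exp_smul hH β
  exact h.smul (RCLike.inv_pos_of_pos h.trace_pos)

theorem trace_gibbs [Nonempty n] {H : Matrix n n ℂ} (hH : H.IsHermitian) (β : ℝ) :
    (gibbs H β).trace = 1 := by
  have h := posDef_exp_smul hH β
  rw [gibbs, trace_smul, smul_eq_mul, inv_mul_cancel₀ h.trace_pos.ne']

theorem gibbs_mul_comm (H : Matrix n n ℂ) (β : ℝ) : H * gibbs H β = gibbs H β * H := by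
  have h : Commute H (NormedSpace.exp (-(β : ℂ) • H)) :=
    ((Commute.refl H).smul_right _).exp_right
  rw [gibbs, Matrix.mul_smul, Matrix.smul_mul, h.eq]

open scoped Matrix.Norms.Operator in
theorem hasDerivAt_exp_smul_linear (H : Matrix n n ℂ) (β : ℝ) (f : Matrix n n ℂ →ₗ[ℝ] ℂ) :
    HasDerivAt (fun b : ℝ => f (NormedSpace.exp (-(b : ℂ) • H)))
      (f (NormedSpace.exp (-(β : ℂ) • H) * -H)) β := by
  have h : ∀ b : ℝ, -(b : ℂ) • H = b • -H := by
    intro b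
    ext i j
    simp
  simp only [h]
  exact f.toContinuousLinearMap.hasFDerivAt.comp_hasDerivAt β
    (hasDerivAt_exp_smul_const (𝕂 := ℝ) (-H) β)

/-- The derivative of the Gibbs state in the inverse temperature is `-½ {H - ⟨H⟩, ω}`. -/
theorem hasDerivAt_gibbs_apply [Nonempty n] {H : Matrix n n ℂ} (hH : H.IsHermitian) (β : ℝ)
    (i j : n) :
    HasDerivAt (fun b : ℝ => gibbs H b i j)
      ((-symMul (gibbs H β) (H - expect (gibbs H β) H • 1)) i j) β := by
  have hZ := (posDef_exp_smul hH β).trace_pos.ne'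
  have h1 := hasDerivAt_exp_smul_linear H β (Matrix.traceLinearMap n ℝ ℂ)
  have h2 := hasDerivAt_exp_smul_linear H β (Matrix.entryLinearMap ℝ ℂ i j)
  have h3 := (h1.inv hZ).mul h2
  refine h3.congr_deriv ?_
  have hsym : symMul (gibbs H β) (H - expect (gibbs H β) H • 1) =
      gibbs H β * H - expect (gibbs H β) H • gibbs H β := by
    rw [sub_eq_add_neg, ← neg_smul, symMul_add, symMul_smul, symMul_one, symMul, gibbs_mul_comm,
      ← two_smul ℂ, smul_smul, neg_smul, ← sub_eq_add_neg]
    norm_num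
  rw [hsym, expect, gibbs_mul_comm]
  simp only [gibbs, Matrix.traceLinearMap_apply, Matrix.entryLinearMap_apply, Matrix.mul_neg,
    trace_neg, Matrix.neg_apply, Pi.inv_apply, Matrix.sub_apply, Matrix.smul_mul, Matrix.smul_apply,
    trace_smul, smul_eq_mul]
  set E := NormedSpace.exp (-(β : ℂ) • H)
  field_simp
  ring

end GibbsState

/-! ### Logarithmic derivatives at a reduced state -/

section LogarithmicDerivatives

variable {V : Type*} [Fintype V] [DecidableEq V]
  {ι : V → Type*} [∀ x, Fintype (ι x)] [∀ x, DecidableEq (ι x)] [∀ x, Nonempty (ι x)]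

/-- Pairing with a reduced symmetric product is a global symmetrized correlation. -/
theorem trace_mul_partialTrace_symMul {A : Finset V} {ω K : Matrix (∀ x, ι x) (∀ x, ι x) ℂ}
    (hω : ω.IsHermitian) (hK : K.IsHermitian)
    {T : Matrix (∀ x : {x // x ∈ A}, ι x) (∀ x : {x // x ∈ A}, ι x) ℂ} (hT : T.IsHermitian) :
    (T * partialTrace A (symMul ω K)).trace = ((expect ω (extend A T * K)).re : ℂ) := by
  rw [← partialTrace_extend_mul, trace_partialTrace,
    trace_mul_symMul hω (isHermitian_extend hT) hK]

/-- Monotonicity of the Bures norm under the partial trace: the symmetric logarithmic derivative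
of `Tr_{Aᶜ} ½ {K, ω}` at the reduced state has second moment at most `Tr[K² ω]`. -/
theorem exists_reduced_sld {A : Finset V} {ω K : Matrix (∀ x, ι x) (∀ x, ι x) ℂ}
    (hω : ω.PosDef) (hK : K.IsHermitian) :
    ∃ L : Matrix (∀ x : {x // x ∈ A}, ι x) (∀ x : {x // x ∈ A}, ι x) ℂ, L.IsHermitian ∧
      symMul (partialTrace A ω) L = partialTrace A (symMul ω K) ∧
      (expect (partialTrace A ω) (L * L)).re ≤ (expect ω (K * K)).re := by
  have hρ := posDef_partialTrace A hω
  obtain ⟨L, hL, hLO⟩ := exists_symMul_eq hρ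
    (isHermitian_partialTrace A (symMul_isHermitian hω.isHermitian hK))
  refine ⟨L, hL, hLO, ?_⟩
  -- `Tr[L² ρ]` is the correlation of `L` with `K`; the Cauchy-Schwarz inequality concludes
  obtain ⟨Φ, hΦ, -⟩ := exists_gns hω.posSemidef
  have h1 := trace_mul_symMul hρ.isHermitian hL hL
  rw [hLO, trace_mul_partialTrace_symMul hω.isHermitian hK hL, Complex.ofReal_inj] at h1
  have hsq : ∀ X : Matrix (∀ x, ι x) (∀ x, ι x) ℂ, X.IsHermitian →
      ‖Φ X‖ ^ 2 = (expect ω (X * X)).re := by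
    intro X hX
    have := hΦ X X
    rw [hX.eq] at this
    rw [← this, inner_self_eq_norm_sq_to_K]
    norm_cast
  have h2 := hsq _ (isHermitian_extend (X := A) hL)
  rw [← extend_mul, expect_extend] at h2
  have h3 : (expect ω (extend A L * K)).re ≤ ‖Φ (extend A L)‖ * ‖Φ K‖ := by
    have := hΦ (extend A L) K
    rw [(isHermitian_extend hL).eq] at this
    rw [← this]
    exact (Complex.re_le_norm _).trans (norm_inner_le_norm _ _)
  rw [h1, ← h2] at h3
  rw [← h2, ← hsq K hK]
  have h4 : ‖Φ (extend A L)‖ ≤ ‖Φ K‖ := by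
    by_contra! h
    nlinarith [norm_nonneg (Φ K)]
  exact pow_le_pow_left₀ (norm_nonneg _) h4 2

/-- If `O` is supported away from `A`, then the symmetric logarithmic derivative of
`Tr_{Aᶜ} ½ {O, ω}` at the reduced state is bounded by `‖O‖`. For an eigenvector `v` with eigenvalue
`l` one has `l ⟨v, ρ v⟩ = Tr[P O P ω]` with the projection `P = |v⟩⟨v| ⊗ 𝟙`, which commutes
with `O`. -/
theorem opNorm_sld_le {A Y : Finset V} {ω O : Matrix (∀ x, ι x) (∀ x, ι x) ℂ}
    (hω : ω.PosDef) (hO : O.IsHermitian) (hAY : Disjoint A Y) (hOY : SupportedIn O Y)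
    {T : Matrix (∀ x : {x // x ∈ A}, ι x) (∀ x : {x // x ∈ A}, ι x) ℂ} (hT : T.IsHermitian)
    (hTO : symMul (partialTrace A ω) T = partialTrace A (symMul ω O)) :
    opNorm T ≤ opNorm O := by
  have hρ := posDef_partialTrace A hω
  obtain ⟨Φ, hΦ, hΦ'⟩ := exists_gns hω.posSemidef
  refine NNReal.coe_le_coe.1 (opNorm_le_of_eigenvalues hT (opNorm O).2 fun v l hv hl => ?_)
  set Q := vecMulVec v.ofLp (star v.ofLp) with hQ
  have hQh : Q.IsHermitian := by
    ext i j
    simp [hQ, vecMulVec_apply, mul_comm]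
  have hvv : star v.ofLp ⬝ᵥ v.ofLp = 1 := by
    have := inner_self_eq_norm_sq_to_K (𝕜 := ℂ) v
    rw [EuclideanSpace.inner_eq_star_dotProduct, hv, dotProduct_comm] at this
    simpa using this
  have hQQ : Q * Q = Q := by
    rw [hQ, vecMulVec_mul_vecMulVec, hvv, one_smul]
  have hTQ : T * Q = (l : ℂ) • Q := by
    rw [hQ, mul_vecMulVec, hl, smul_vecMulVec]
  set t := (expect (partialTrace A ω) Q).re with ht
  have htpos : 0 < t := by
    have h1 : expect (partialTrace A ω) Q = star v.ofLp ⬝ᵥ (partialTrace A ω *ᵥ v.ofLp) := by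
      rw [expect, hQ, trace_mul_comm, mul_vecMulVec, trace_vecMulVec, dotProduct_comm]
    have h2 : v.ofLp ≠ 0 := by
      intro h0
      rw [h0] at hvv
      simp at hvv
    have h3 := hρ.dotProduct_mulVec_pos h2
    rw [ht, h1]
    exact (Complex.lt_def.1 h3).1
  -- both sides are the trace of `Q` against `Tr_{Aᶜ} ½ {O, ω} = ½ {T, ρ}`
  have hlt : l * t = (expect ω (extend A Q * O)).re := by
    have h1 := trace_mul_partialTrace_symMul (A := A) hω.isHermitian hO hQh
    rw [← hTO, trace_mul_symMul hρ.isHermitian hQh hT, Complex.ofReal_inj] at h1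
    rw [← h1]
    have h2 : Q * T = (l : ℂ) • Q := by
      have := congrArg conjTranspose hTQ
      rw [conjTranspose_mul, conjTranspose_smul, hQh.eq, hT.eq] at this
      simpa using this
    rw [h2, expect_smul, Complex.re_ofReal_mul]
  have hPP : extend A Q * extend A Q = extend A Q := by rw [← extend_mul, hQQ]
  have hPh := isHermitian_extend (X := A) hQh
  have hΦP : ‖Φ (extend A Q)‖ ^ 2 = t := by
    have := hΦ (extend A Q) (extend A Q)
    rw [hPh.eq, hPP, expect_extend] at this
    rw [ht, ← this, inner_self_eq_norm_sq_to_K]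
    norm_cast
  have hcomm := commute_of_disjoint hAY ⟨Q, rfl⟩ hOY
  have hle : |l * t| ≤ opNorm O * t := by
    have h1 : expect ω (extend A Q * O) = inner ℂ (Φ (extend A Q)) (Φ (O * extend A Q)) := by
      rw [hΦ, hPh.eq, ← hcomm, ← Matrix.mul_assoc, hPP]
    rw [hlt, h1, ← hΦP]
    refine (Complex.abs_re_le_norm _).trans ((norm_inner_le_norm _ _).trans ?_)
    nlinarith [hΦ' O (extend A Q), norm_nonneg (Φ (extend A Q))]
  rw [abs_mul, abs_of_pos htpos] at hle
  exact le_of_mul_le_mul_right hle htpos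

/-- The symmetric logarithmic derivative of `Tr_{Aᶜ} ½ {O - ⟨O⟩, ω}` for `O` supported away from
`A`: its second moment is a correlation between `O` and an observable of `A` of norm at most
`‖O‖`. -/
theorem exists_sld_of_disjoint {A Y : Finset V} {ω O : Matrix (∀ x, ι x) (∀ x, ι x) ℂ}
    (hω : ω.PosDef) (hO : O.IsHermitian) (hAY : Disjoint A Y) (hOY : SupportedIn O Y)
    (hω1 : ω.trace = 1) :
    ∃ L T : Matrix (∀ x : {x // x ∈ A}, ι x) (∀ x : {x // x ∈ A}, ι x) ℂ,
      L.IsHermitian ∧ T.IsHermitian ∧ opNorm T ≤ opNorm O ∧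
      symMul (partialTrace A ω) L = partialTrace A (symMul ω (O - expect ω O • 1)) ∧
      (expect (partialTrace A ω) (L * L)).re =
        (expect ω (extend A T * O) - expect ω (extend A T) * expect ω O).re := by
  have hρ := posDef_partialTrace A hω
  obtain ⟨T, hT, hTO⟩ := exists_symMul_eq hρ
    (isHermitian_partialTrace A (symMul_isHermitian hω.isHermitian hO))
  set h : ℝ := (expect ω O).re with hh
  have hexp : expect ω O = (h : ℂ) := expect_eq_re hω.isHermitian hO
  have hct : (((-h : ℝ) : ℂ) • (1 : Matrix (∀ x : {x // x ∈ A}, ι x) _ ℂ)).IsHermitian := by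
    unfold Matrix.IsHermitian
    rw [conjTranspose_smul, conjTranspose_one, Complex.star_def, Complex.conj_ofReal]
  have hL : (T + ((-h : ℝ) : ℂ) • 1).IsHermitian := hT.add hct
  have hLs : symMul (partialTrace A ω) (T + ((-h : ℝ) : ℂ) • 1) =
      partialTrace A (symMul ω (O - expect ω O • 1)) := by
    rw [hexp, sub_eq_add_neg, ← neg_smul, symMul_add, symMul_add, symMul_smul, symMul_smul,
      symMul_one, symMul_one, hTO, partialTrace_add, partialTrace_smul]
    simp
  refine ⟨T + ((-h : ℝ) : ℂ) • 1, T, hL, hT, opNorm_sld_le hω hO hAY hOY hT hTO, hLs, ?_⟩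
  -- `⟨T⟩ = ⟨O⟩`, so that the shift by `⟨O⟩` turns the second moment into a correlation
  have h1 : expect (partialTrace A ω) T = h := by
    have := trace_mul_symMul hρ.isHermitian
      (isHermitian_one (n := ∀ x : {x // x ∈ A}, ι x) (α := ℂ)) hT
    rw [Matrix.one_mul, Matrix.one_mul, hTO, trace_partialTrace,
      ← expect_eq_re hρ.isHermitian hT] at this
    rw [← this]
    have := trace_mul_symMul hω.isHermitian
      (isHermitian_one (n := ∀ x, ι x) (α := ℂ)) hO
    rw [Matrix.one_mul, Matrix.one_mul] at this
    exact this
  have h2 := trace_mul_symMul hρ.isHermitian hT hT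
  rw [hTO, trace_mul_partialTrace_symMul hω.isHermitian hO hT, Complex.ofReal_inj] at h2
  have h3 : expect (partialTrace A ω) 1 = 1 := by
    rw [expect, Matrix.one_mul, trace_partialTrace, hω1]
  rw [Complex.sub_re, h2, expect_extend, h1, hexp]
  have h4 : (T + ((-h : ℝ) : ℂ) • 1) * (T + ((-h : ℝ) : ℂ) • 1) =
      T * T + ((-2 * h : ℝ) : ℂ) • T + ((h * h : ℝ) : ℂ) • 1 := by
    simp only [Matrix.add_mul, Matrix.mul_add, Matrix.smul_mul, Matrix.mul_smul, Matrix.mul_one,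
      Matrix.one_mul]
    push_cast
    module
  rw [h4, expect_add, expect_add, expect_smul, expect_smul, h1, h3]
  simp
  ring

end LogarithmicDerivatives

/-! ### Quadratically weighted geometric sums -/

section Series

/-- The value of `∑_m (n + m + 1)² q^m` in terms of `s = (1 - q)⁻¹`. -/
noncomputable def quadTail (s : ℝ) (n : ℕ) : ℝ :=
  ((n : ℝ) + 1) ^ 2 * s + 2 * (n + 1) * ((s - 1) * s) + s * (s - 1) * (2 * s - 1)

theorem quadTail_nonneg {s : ℝ} (hs : 1 ≤ s) (n : ℕ) : 0 ≤ quadTail s n := by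
  have h1 : 0 ≤ s - 1 := by linarith
  have h2 : 0 ≤ 2 * s - 1 := by linarith
  have h3 : 0 ≤ s := by linarith
  unfold quadTail
  positivity

/-- The recursion of the tails, by which their partial sums telescope. -/
theorem quadTail_sub {q : ℝ} (hq : q < 1) (n : ℕ) :
    quadTail (1 - q)⁻¹ n - q * quadTail (1 - q)⁻¹ (n + 1) = ((n : ℝ) + 1) ^ 2 := by
  have h : 1 - q ≠ 0 := by linarith
  unfold quadTail
  push_cast
  field_simp
  ring

theorem sum_Ico_le_quadTail {q : ℝ} (hq0 : 0 ≤ q) (hq : q < 1) (R K : ℕ) :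
    ∑ n ∈ Finset.Ico R K, ((n : ℝ) + 1) ^ 2 * q ^ n ≤ q ^ R * quadTail (1 - q)⁻¹ R := by
  have hs : 1 ≤ (1 - q)⁻¹ := (one_le_inv₀ (by linarith)).2 (by linarith)
  rcases le_total K R with h | h
  · rw [Finset.Ico_eq_empty_of_le h, Finset.sum_empty]
    exact mul_nonneg (pow_nonneg hq0 _) (quadTail_nonneg hs _)
  · have key : ∑ n ∈ Finset.Ico R K, ((n : ℝ) + 1) ^ 2 * q ^ n + q ^ K * quadTail (1 - q)⁻¹ K =
        q ^ R * quadTail (1 - q)⁻¹ R := by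
      induction K, h using Nat.le_induction with
      | base => simp
      | succ K hK ih =>
        rw [Finset.sum_Ico_succ_top hK, ← ih, ← quadTail_sub hq K, pow_succ]
        ring
    have := mul_nonneg (pow_nonneg hq0 K) (quadTail_nonneg hs K)
    linarith

theorem inv_one_sub_exp_le {η : ℝ} (hη : 0 < η) : (1 - Real.exp (-1 / η))⁻¹ ≤ η + 1 := by
  have h1 : 1 / η + 1 ≤ Real.exp (1 / η) := Real.add_one_le_exp _
  have h2 : Real.exp (-1 / η) ≤ (1 / η + 1)⁻¹ := by
    rw [neg_div, Real.exp_neg]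
    exact inv_anti₀ (by positivity) h1
  have h3 : (1 / η + 1)⁻¹ = 1 - (η + 1)⁻¹ := by field_simp; ring
  rw [h3] at h2
  rw [inv_le_comm₀ (by linarith [inv_pos.2 (show 0 < η + 1 by linarith)]) (by linarith)]
  linarith

theorem quadTail_zero_le {s c : ℝ} (hs : 1 ≤ s) (hc : s ≤ c) : quadTail s 0 ≤ 2 * c ^ 3 := by
  have h : s ^ 3 ≤ c ^ 3 := pow_le_pow_left₀ (by linarith) hc 3
  unfold quadTail
  push_cast
  nlinarith [sq_nonneg s]

/-- For `s ≤ R` the three terms of the tail are of the same order `R² s`. -/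
theorem quadTail_le {s : ℝ} (hs : 1 ≤ s) {R : ℕ} (hR : s ≤ R) :
    quadTail s R ≤ 5 * (R : ℝ) ^ 2 * s := by
  have h1 : 0 ≤ s - 1 := by linarith
  have h : ((R : ℝ) + 1) ^ 2 + 2 * (R + 1) * (s - 1) + (s - 1) * (2 * s - 1) ≤
      5 * (R : ℝ) ^ 2 := by nlinarith
  calc quadTail s R
      = (((R : ℝ) + 1) ^ 2 + 2 * (R + 1) * (s - 1) + (s - 1) * (2 * s - 1)) * s := by
        unfold quadTail; ring
    _ ≤ _ := mul_le_mul_of_nonneg_right h (by linarith)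

end Series

/-! ### Distances and growth -/

section Distances

variable {V : Type*} [Fintype V] [DecidableEq V]

theorem decay_coe (ξ : ℝ) (n : ℕ) : decay ξ (n : ℕ∞) = Real.exp (-(n : ℝ) / ξ) := rfl

theorem decay_top (ξ : ℝ) : decay ξ ⊤ = 0 := rfl

theorem decay_zero (ξ : ℝ) : decay ξ 0 = 1 := by
  have := decay_coe ξ 0
  simpa using this

theorem decay_nonneg (ξ : ℝ) (d : ℕ∞) : 0 ≤ decay ξ d := by
  induction d using ENat.recTopCoe with
  | top => exact le_rfl
  | coe n => exact (Real.exp_pos _).le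

/-- Taking the square root doubles the decay length, also at infinite distance. -/
theorem sqrt_decay (ξ : ℝ) (d : ℕ∞) : √(decay ξ d) = decay (2 * ξ) d := by
  induction d using ENat.recTopCoe with
  | top => exact Real.sqrt_zero
  | coe n =>
    rw [decay_coe, decay_coe, ← Real.exp_half, div_div, mul_comm]

theorem Joins.reverse {E : Finset (Finset V)} {x y : V} {l : List (Finset V)}
    (h : Joins E x y l) : Joins E y x l.reverse := by
  obtain ⟨h1, h2, h3, h4⟩ := h
  refine ⟨fun X hX => h1 X (List.mem_reverse.1 hX), ?_, ?_, ?_⟩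
  · rw [List.isChain_reverse]
    exact h2.imp fun X Y h => by rwa [Finset.inter_comm]
  · simpa using h4
  · simpa using h3

theorem dist_comm (E : Finset (Finset V)) (x y : V) : dist E x y = dist E y x := by
  have key : ∀ x y : V, dist E x y ≤ dist E y x := by
    intro x y
    unfold dist
    by_cases h : x = y
    · simp [h]
    · rw [if_neg h, if_neg (Ne.symm h)]
      refine le_iInf₂ fun l hl => ?_
      refine (iInf₂_le l.reverse hl.reverse).trans ?_
      rw [List.length_reverse]
  exact le_antisymm (key x y) (key y x)

theorem distSet_comm (E : Finset (Finset V)) (X Y : Finset V) :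
    distSet E X Y = distSet E Y X := by
  unfold distSet distSite
  rw [iInf₂_comm]
  simp only [dist_comm E]

theorem distSet_eq_zero (E : Finset (Finset V)) {X Y : Finset V} (h : ¬ Disjoint X Y) :
    distSet E X Y = 0 := by
  obtain ⟨x, hx, hy⟩ := Finset.not_disjoint_iff.1 h
  refine le_antisymm ?_ bot_le
  refine (iInf₂_le x hx).trans ((iInf₂_le x hy).trans ?_)
  simp [dist]

theorem distSet_le_distSite (E : Finset (Finset V)) {X : Finset V} (Y : Finset V) {x : V}
    (hx : x ∈ X) : distSet E X Y ≤ distSite E x Y := iInf₂_le x hx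

theorem decay_distSet_le (E : Finset (Finset V)) (ξ : ℝ) (X Y : Finset V) :
    decay ξ (distSet E X Y) ≤ ∑ x ∈ X, decay ξ (distSite E x Y) := by
  rcases X.eq_empty_or_nonempty with rfl | hX
  · simp [distSet, decay_top]
  · obtain ⟨x, hx, h⟩ := Finset.exists_mem_eq_inf X hX fun x => distSite E x Y
    rw [Finset.inf_eq_iInf] at h
    unfold distSet
    rw [h]
    exact Finset.single_le_sum (f := fun x => decay ξ (distSite E x Y))
      (fun x _ => decay_nonneg _ _) hx

variable {ι : V → Type*} [∀ x, Fintype (ι x)] [∀ x, DecidableEq (ι x)]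

/-- Polynomial growth makes the exponentially weighted number of edges at distance at least `R`
from a site finite; the edges are summed shell by shell. -/
theorem System.GrowthBound.sum_decay_le {S : System V ι} {M : ℝ} (hM : S.GrowthBound M)
    {η : ℝ} (hη : 0 < η) (x : V) {G : Finset (Finset V)} (hG : G ⊆ S.edges) (R : ℕ)
    (hR : ∀ Y ∈ G, (R : ℕ∞) ≤ distSite S.edges x Y) :
    ∑ Y ∈ G, decay η (distSite S.edges x Y) ≤
      M * (Real.exp (-(R : ℝ) / η) * quadTail (1 - Real.exp (-1 / η))⁻¹ R) := by
  classical
  set q := Real.exp (-1 / η) with hq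
  have hq1 : q < 1 := by
    rw [hq, Real.exp_lt_one_iff]
    exact div_neg_of_neg_of_pos (by norm_num) hη
  have hqn : ∀ n : ℕ, Real.exp (-(n : ℝ) / η) = q ^ n := by
    intro n
    rw [hq, ← Real.exp_nat_mul]
    congr 1
    ring
  set d := fun Y => distSite S.edges x Y with hd
  -- all finite distances are less than `K`
  set K := G.sup (fun Y => (d Y).toNat) + 1 with hK
  have h1 : ∀ Y ∈ G, decay η (d Y) ≤ ∑ n ∈ Finset.Ico R K, if d Y = (n : ℕ∞) then q ^ n else 0 := by
    intro Y hY
    have hnn : ∀ n ∈ Finset.Ico R K, 0 ≤ if d Y = (n : ℕ∞) then q ^ n else 0 := by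
      intro n _
      split_ifs
      · exact pow_nonneg (Real.exp_pos _).le _
      · exact le_rfl
    -- edges at infinite distance lie in no shell, but have weight `0`
    rcases eq_or_ne (d Y) ⊤ with h | h
    · rw [h, decay_top, ← h]
      exact Finset.sum_nonneg hnn
    · obtain ⟨m, hm⟩ := ENat.ne_top_iff_exists.1 h
      have hmem : m ∈ Finset.Ico R K := by
        rw [Finset.mem_Ico]
        constructor
        · have := hR Y hY
          change (R : ℕ∞) ≤ d Y at this
          rw [← hm] at this
          exact_mod_cast this
        · have := Finset.le_sup (f := fun Y => (d Y).toNat) hY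
          simp only [← hm, ENat.toNat_natCast] at this
          omega
      refine le_trans ?_ (Finset.single_le_sum hnn hmem)
      rw [if_pos hm.symm, ← hm, decay_coe, hqn]
  have h2 : ∀ n : ℕ, (∑ Y ∈ G, if d Y = (n : ℕ∞) then q ^ n else 0) ≤
      M * (((n : ℝ) + 1) ^ 2 * q ^ n) := by
    intro n
    rw [← Finset.sum_filter, Finset.sum_const, nsmul_eq_mul, ← mul_assoc]
    refine mul_le_mul_of_nonneg_right ?_ (pow_nonneg (Real.exp_pos _).le _)
    refine le_trans ?_ (hM.2 x n)
    rw [← Set.ncard_coe_finset]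
    have hfin : ({Y | Y ∈ S.edges ∧ distSite S.edges x Y = (n : ℕ∞)} : Set (Finset V)).Finite :=
      S.edges.finite_toSet.subset fun Y hY => hY.1
    refine Nat.cast_le.2 (Set.ncard_le_ncard (fun Y hY => ?_) hfin)
    rw [Finset.mem_coe, Finset.mem_filter] at hY
    exact ⟨hG hY.1, hY.2⟩
  calc ∑ Y ∈ G, decay η (d Y)
      ≤ ∑ Y ∈ G, ∑ n ∈ Finset.Ico R K, if d Y = (n : ℕ∞) then q ^ n else 0 :=
        Finset.sum_le_sum h1
    _ = ∑ n ∈ Finset.Ico R K, ∑ Y ∈ G, if d Y = (n : ℕ∞) then q ^ n else 0 := Finset.sum_comm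
    _ ≤ ∑ n ∈ Finset.Ico R K, M * (((n : ℝ) + 1) ^ 2 * q ^ n) :=
        Finset.sum_le_sum fun n _ => h2 n
    _ ≤ _ := by
        rw [← Finset.mul_sum, hqn]
        exact mul_le_mul_of_nonneg_left
          (sum_Ico_le_quadTail (Real.exp_pos _).le hq1 R K) hM.1.le

theorem one_le_inv_one_sub_exp {η : ℝ} (hη : 0 < η) : 1 ≤ (1 - Real.exp (-1 / η))⁻¹ := by
  have hq1 : Real.exp (-1 / η) < 1 := by
    rw [Real.exp_lt_one_iff]
    exact div_neg_of_neg_of_pos (by norm_num) hη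
  exact (one_le_inv₀ (by linarith)).2 (by linarith [Real.exp_pos (-1 / η)])

/-- The exponentially weighted number of edges around a subsystem. -/
theorem System.GrowthBound.sum_decay_distSet_le {S : System V ι} {M : ℝ} (hM : S.GrowthBound M)
    {ξ : ℝ} (hξ : 0 < ξ) (X : Finset V) {G : Finset (Finset V)} (hG : G ⊆ S.edges) :
    ∑ Y ∈ G, decay ξ (distSet S.edges X Y) ≤ X.card * (M * (2 * (ξ + 1) ^ 3)) := by
  calc ∑ Y ∈ G, decay ξ (distSet S.edges X Y)
      ≤ ∑ Y ∈ G, ∑ x ∈ X, decay ξ (distSite S.edges x Y) :=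
        Finset.sum_le_sum fun Y _ => decay_distSet_le _ _ _ _
    _ = ∑ x ∈ X, ∑ Y ∈ G, decay ξ (distSite S.edges x Y) := Finset.sum_comm
    _ ≤ ∑ x ∈ X, M * (2 * (ξ + 1) ^ 3) := by
        refine Finset.sum_le_sum fun x _ => ?_
        refine (hM.sum_decay_le hξ x hG 0 fun Y _ => by simp).trans ?_
        have := quadTail_zero_le (one_le_inv_one_sub_exp hξ) (inv_one_sub_exp_le hξ)
        refine mul_le_mul_of_nonneg_left ?_ hM.1.le
        simpa using this
    _ = _ := by rw [Finset.sum_const, nsmul_eq_mul]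

/-- The exponentially weighted number of edges at distance at least `R` from `A`, for the decay
length `2 ξ` that the square root of a correlation has. -/
theorem System.GrowthBound.sum_decay_far_le {S : System V ι} {M : ℝ} (hM : S.GrowthBound M)
    {ξ : ℝ} (hξ : 0 < ξ) (A : Finset V) {G : Finset (Finset V)} (hG : G ⊆ S.edges) {R : ℕ}
    (hR : 2 * ξ + 1 ≤ (R : ℝ)) (hGR : ∀ Y ∈ G, (R : ℕ∞) ≤ distSet S.edges A Y) :
    ∑ Y ∈ G, decay (2 * ξ) (distSet S.edges A Y) ≤
      A.card * (M * (Real.exp (-(R : ℝ) / (2 * ξ)) * (10 * (R : ℝ) ^ 2 * (ξ + 1)))) := by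
  calc ∑ Y ∈ G, decay (2 * ξ) (distSet S.edges A Y)
      ≤ ∑ Y ∈ G, ∑ x ∈ A, decay (2 * ξ) (distSite S.edges x Y) :=
        Finset.sum_le_sum fun Y _ => decay_distSet_le _ _ _ _
    _ = ∑ x ∈ A, ∑ Y ∈ G, decay (2 * ξ) (distSite S.edges x Y) := Finset.sum_comm
    _ ≤ ∑ x ∈ A, M * (Real.exp (-(R : ℝ) / (2 * ξ)) * (10 * (R : ℝ) ^ 2 * (ξ + 1))) := by
        refine Finset.sum_le_sum fun x hx => ?_
        have hξ2 : 0 < 2 * ξ := by positivity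
        refine (hM.sum_decay_le hξ2 x hG R fun Y hY =>
          (hGR Y hY).trans (distSet_le_distSite _ _ hx)).trans ?_
        have hs := inv_one_sub_exp_le hξ2
        have h := quadTail_le (one_le_inv_one_sub_exp hξ2) (hs.trans hR)
        refine mul_le_mul_of_nonneg_left (mul_le_mul_of_nonneg_left ?_ (Real.exp_pos _).le)
          hM.1.le
        nlinarith [sq_nonneg (R : ℝ)]
    _ = _ := by rw [Finset.sum_const, nsmul_eq_mul]

end Distances

/-! ### Fluctuations -/

section Centered

variable {n : Type*} [Fintype n] [DecidableEq n]

/-- The fluctuation `O - ⟨O⟩` of an observable. -/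
noncomputable def centered (ω O : Matrix n n ℂ) : Matrix n n ℂ := O - expect ω O • 1

theorem centered_add (ω O O' : Matrix n n ℂ) :
    centered ω (O + O') = centered ω O + centered ω O' := by
  simp only [centered, expect_add, add_smul]; abel

theorem centered_sum {κ : Type*} (ω : Matrix n n ℂ) (s : Finset κ) (O : κ → Matrix n n ℂ) :
    centered ω (∑ k ∈ s, O k) = ∑ k ∈ s, centered ω (O k) := by
  simp only [centered, expect_sum, Finset.sum_smul, Finset.sum_sub_distrib]

theorem isHermitian_centered {ω O : Matrix n n ℂ} (hω : ω.IsHermitian) (hO : O.IsHermitian) :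
    (centered ω O).IsHermitian := by
  unfold Matrix.IsHermitian
  rw [centered, conjTranspose_sub, conjTranspose_smul, conjTranspose_one, hO.eq,
    star_expect hω, hO.eq]

theorem re_expect_centered_mul_self {ω : Matrix n n ℂ} (hω1 : ω.trace = 1) (O : Matrix n n ℂ) :
    (expect ω (centered ω O * centered ω O)).re = variance ω O := by
  have h1 : expect ω 1 = 1 := by rw [expect, Matrix.one_mul, hω1]
  have h2 : centered ω O * centered ω O =
      O * O + (-2 * expect ω O) • O + (expect ω O * expect ω O) • 1 := by
    simp only [centered, Matrix.sub_mul, Matrix.mul_sub, Matrix.smul_mul, Matrix.mul_smul,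
      Matrix.mul_one, Matrix.one_mul]
    module
  rw [variance, h2, expect_add, expect_add, expect_smul, expect_smul, h1]
  congr 1
  ring

end Centered

/-! ### Fluctuations of the edge terms -/

namespace System

variable {V : Type*} [Fintype V] [DecidableEq V]
  {ι : V → Type*} [∀ x, Fintype (ι x)] [∀ x, DecidableEq (ι x)] {S : System V ι}

theorem J_nonneg : 0 ≤ S.J := NNReal.coe_nonneg _

theorem opNorm_term_le {X : Finset V} (hX : X ∈ S.edges) : (opNorm (S.term X) : ℝ) ≤ S.J :=
  NNReal.coe_le_coe.2 (Finset.le_sup (f := fun X => opNorm (S.term X)) hX)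

theorem card_boundary_le {X : Finset V} (hX : X ∈ S.edges) :
    (boundary S.edges X).card ≤ S.Nbd :=
  Finset.le_sup (f := fun X => (boundary S.edges X).card) hX

theorem card_le_N {X : Finset V} (hX : X ∈ S.edges) : X.card ≤ S.N :=
  Finset.le_sup (f := fun X => X.card) hX

theorem isHermitian_partialHam {G : Finset (Finset V)} (hG : G ⊆ S.edges) :
    (S.partialHam G).IsHermitian := by
  unfold partialHam Matrix.IsHermitian
  rw [conjTranspose_sum]
  exact Finset.sum_congr rfl fun X hX => S.isHermitian X (hG hX)

theorem localHam_isHermitian (A : Finset V) : (S.localHam A).IsHermitian :=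
  isHermitian_partialHam (Finset.filter_subset _ _)

variable [∀ x, Nonempty (ι x)]

theorem posDef_state (S : System V ι) (β : ℝ) : (S.state β).PosDef :=
  posDef_gibbs S.ham_isHermitian β

theorem trace_state (S : System V ι) (β : ℝ) : (S.state β).trace = 1 :=
  trace_gibbs S.ham_isHermitian β

/-- Correlations of two edge terms. Overlapping edges are at distance `0`, and there the bound
holds since `N_∂ ≥ 1`. -/
theorem IsCorrelationLength.norm_cov_le {β ξ : ℝ} (hξ : S.IsCorrelationLength β ξ)
    (hN : 1 ≤ S.Nbd) {X Y : Finset V} (hX : X ∈ S.edges) (hY : Y ∈ S.edges) :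
    ‖expect (S.state β) (S.term X * S.term Y) -
        expect (S.state β) (S.term X) * expect (S.state β) (S.term Y)‖ ≤
      4 * (ξ + 1) * S.Nbd * S.J ^ 2 * decay ξ (distSet S.edges X Y) := by
  have hξ0 := hξ.1
  have hJ := J_nonneg (S := S)
  have hJX := opNorm_term_le hX
  have hJY := opNorm_term_le hY
  by_cases hd : Disjoint X Y
  · refine (hξ.2 X Y hd _ _ (S.isHermitian X hX) (S.isHermitian Y hY) (S.supported X hX)
      (S.supported Y hY)).trans ?_
    refine mul_le_mul_of_nonneg_right ?_ (decay_nonneg _ _)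
    have hmin : ((min (boundary S.edges X).card (boundary S.edges Y).card : ℕ) : ℝ) ≤ S.Nbd :=
      Nat.cast_le.2 ((min_le_left _ _).trans (card_boundary_le hX))
    rw [pow_two, ← mul_assoc]
    gcongr
  · rw [distSet_eq_zero _ hd, decay_zero, mul_one]
    have hω := posDef_state S β
    have hN' : (1 : ℝ) ≤ S.Nbd := by exact_mod_cast hN
    have hop : (opNorm (S.term X * S.term Y) : ℝ) ≤ S.J * S.J := by
      refine le_trans ?_ (mul_le_mul hJX hJY (NNReal.coe_nonneg _) hJ)
      unfold opNorm
      rw [map_mul]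
      exact norm_mul_le _ _
    have h1 := (norm_expect_le hω.posSemidef (trace_state S β) (S.term X * S.term Y)).trans hop
    have h2 := (norm_expect_le hω.posSemidef (trace_state S β) (S.term X)).trans hJX
    have h3 := (norm_expect_le hω.posSemidef (trace_state S β) (S.term Y)).trans hJY
    have h4 := mul_le_mul h2 h3 (norm_nonneg _) hJ
    rw [← norm_mul] at h4
    refine (norm_sub_le _ _).trans ((add_le_add h1 h4).trans ?_)
    have h5 : (1 : ℝ) ≤ (ξ + 1) * S.Nbd := by nlinarith
    nlinarith [mul_nonneg hJ hJ]

/-- The variance of a partial Hamiltonian is extensive in the number of its terms. -/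
theorem variance_partialHam_le {β ξ M : ℝ} (hξ : S.IsCorrelationLength β ξ)
    (hN : 1 ≤ S.Nbd) (hM : S.GrowthBound M) {G : Finset (Finset V)} (hG : G ⊆ S.edges) :
    variance (S.state β) (S.partialHam G) ≤
      8 * S.J ^ 2 * M * S.N * S.Nbd * (ξ + 1) ^ 4 * G.card := by
  set ω := S.state β
  have hξ0 := hξ.1
  have hM0 := hM.1
  have h1 : expect ω (S.partialHam G * S.partialHam G) - expect ω (S.partialHam G) ^ 2 =
      ∑ X ∈ G, ∑ Y ∈ G, (expect ω (S.term X * S.term Y) -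
        expect ω (S.term X) * expect ω (S.term Y)) := by
    rw [partialHam, Finset.sum_mul_sum, expect_sum, expect_sum, pow_two, Finset.sum_mul_sum,
      ← Finset.sum_sub_distrib]
    exact Finset.sum_congr rfl fun X _ => by rw [expect_sum, ← Finset.sum_sub_distrib]
  rw [variance, h1]
  refine (Complex.re_le_norm _).trans ?_
  calc _ ≤ ∑ X ∈ G, ∑ Y ∈ G, 4 * (ξ + 1) * S.Nbd * S.J ^ 2 * decay ξ (distSet S.edges X Y) :=
        (norm_sum_le _ _).trans (Finset.sum_le_sum fun X hX => (norm_sum_le _ _).trans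
          (Finset.sum_le_sum fun Y hY => hξ.norm_cov_le hN (hG hX) (hG hY)))
    _ ≤ ∑ X ∈ G, 4 * (ξ + 1) * S.Nbd * S.J ^ 2 * (S.N * (M * (2 * (ξ + 1) ^ 3))) := by
        refine Finset.sum_le_sum fun X hX => ?_
        rw [← Finset.mul_sum]
        refine mul_le_mul_of_nonneg_left ?_ (by positivity)
        refine (hM.sum_decay_distSet_le hξ0 X hG).trans ?_
        have : (X.card : ℝ) ≤ S.N := Nat.cast_le.2 (card_le_N (hG hX))
        gcongr
    _ = _ := by
        rw [Finset.sum_const, nsmul_eq_mul]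
        ring

/-- The reduced derivative is `-Tr_{Aᶜ} ½ {H - ⟨H⟩, ω}`. -/
theorem reducedDeriv_eq (S : System V ι) (A : Finset V) (β : ℝ) :
    S.reducedDeriv A β =
      -partialTrace A (symMul (S.state β) (centered (S.state β) S.ham)) := by
  ext a a'
  have h := HasDerivAt.fun_sum (u := Finset.univ) fun (b : ∀ x : {x // ¬ x ∈ A}, ι x) _ =>
    hasDerivAt_gibbs_apply S.ham_isHermitian β ((split ι A).symm (a, b))
      ((split ι A).symm (a', b))
  refine h.deriv.trans ?_
  rw [Matrix.neg_apply]
  simp only [partialTrace, of_apply, Matrix.neg_apply, Finset.sum_neg_distrib]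
  rfl

/-- The local Hamiltonian is an operator of the subsystem `A`. -/
theorem exists_localHam_eq_extend (S : System V ι) (A : Finset V) :
    ∃ T : Matrix (∀ x : {x // x ∈ A}, ι x) (∀ x : {x // x ∈ A}, ι x) ℂ,
      T.IsHermitian ∧ S.localHam A = extend A T := by
  obtain ⟨T, hT⟩ : SupportedIn (S.localHam A) A :=
    SupportedIn.sum fun X hX => (S.supported X (Finset.mem_filter.1 hX).1).mono
      (Finset.mem_filter.1 hX).2
  -- the Hermitian part of `T` still extends to the Hermitian `H_A`
  refine ⟨(1 / 2 : ℂ) • (T + Tᴴ), ?_, ?_⟩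
  · unfold Matrix.IsHermitian
    rw [conjTranspose_smul, conjTranspose_add, conjTranspose_conjTranspose, add_comm]
    simp
  · rw [extend_smul, extend_add, extend_conjTranspose, ← hT, (localHam_isHermitian A).eq,
      ← two_smul ℂ, smul_smul]
    norm_num

/-- Each edge term far from `A` has a symmetric logarithmic derivative at the reduced state whose
second moment decays exponentially with the distance. -/
theorem IsCorrelationLength.exists_sld_term {β ξ : ℝ} (hξ : S.IsCorrelationLength β ξ)
    {A Y : Finset V} (hY : Y ∈ S.edges) (hAY : Disjoint A Y) :
    ∃ L : Matrix (∀ x : {x // x ∈ A}, ι x) (∀ x : {x // x ∈ A}, ι x) ℂ, L.IsHermitian ∧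
      symMul (S.reduced A β) L =
        partialTrace A (symMul (S.state β) (centered (S.state β) (S.term Y))) ∧
      √(expect (S.reduced A β) (L * L)).re ≤
        2 * S.J * √(S.Nbd : ℝ) * √(ξ + 1) * decay (2 * ξ) (distSet S.edges A Y) := by
  have hξ0 := hξ.1
  have hJ := J_nonneg (S := S)
  have hJY := opNorm_term_le hY
  obtain ⟨L, T, hL, hT, hTn, hLs, hLL⟩ := exists_sld_of_disjoint (posDef_state S β)
    (S.isHermitian Y hY) hAY (S.supported Y hY) (trace_state S β)
  refine ⟨L, hL, hLs, ?_⟩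
  have hTJ : (opNorm (extend A T) : ℝ) ≤ S.J :=
    (NNReal.coe_le_coe.2 ((opNorm_extend_le A T).trans hTn)).trans hJY
  have hmin : ((min (boundary S.edges A).card (boundary S.edges Y).card : ℕ) : ℝ) ≤ S.Nbd :=
    Nat.cast_le.2 ((min_le_right _ _).trans (card_boundary_le hY))
  have h1 : (expect (S.reduced A β) (L * L)).re ≤
      4 * (ξ + 1) * S.Nbd * S.J * S.J * decay ξ (distSet S.edges A Y) := by
    rw [reduced, hLL]
    refine (Complex.re_le_norm _).trans ?_
    refine (hξ.2 A Y hAY _ _ (isHermitian_extend hT) (S.isHermitian Y hY) ⟨T, rfl⟩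
      (S.supported Y hY)).trans ?_
    refine mul_le_mul_of_nonneg_right ?_ (decay_nonneg _ _)
    gcongr
  refine (Real.sqrt_le_sqrt h1).trans (le_of_eq ?_)
  have h2 : 4 * (ξ + 1) * S.Nbd * S.J * S.J * decay ξ (distSet S.edges A Y) =
      (2 * S.J) ^ 2 * (S.Nbd * ((ξ + 1) * decay ξ (distSet S.edges A Y))) := by ring
  rw [h2, Real.sqrt_mul (by positivity), Real.sqrt_sq (by positivity),
    Real.sqrt_mul (by positivity), Real.sqrt_mul (by positivity), sqrt_decay]
  ring

open Classical in
/-- The edges not contained in `A` at distance at least `R` from `A`. -/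
noncomputable def farEdges (S : System V ι) (A : Finset V) (R : ℕ) : Finset (Finset V) :=
  (S.edges \ S.innerEdges A).filter fun X => ¬ distSet S.edges X A < (R : ℕ∞)

theorem ham_eq_add (S : System V ι) (A : Finset V) (R : ℕ) :
    S.ham = S.localHam A + S.partialHam (S.collar A R) + S.partialHam (S.farEdges A R) := by
  classical
  unfold ham localHam partialHam collar farEdges
  rw [add_assoc, Finset.sum_filter_add_sum_filter_not, add_comm,
    Finset.sum_sdiff (s₁ := S.innerEdges A) (Finset.filter_subset _ _)]

end System

end QLattice

open QLattice QLattice.System Matrix in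
open scoped ComplexOrder in
theorem corollary1 {V : Type*} [Fintype V] [DecidableEq V]
    {ι : V → Type*} [∀ x, Fintype (ι x)] [∀ x, DecidableEq (ι x)] [∀ x, Nonempty (ι x)]
    (S : QLattice.System V ι) (hN : 1 ≤ S.Nbd)
    (M : ℝ) (hM : S.GrowthBound M)
    (β ξ : ℝ) (hξ : S.IsCorrelationLength β ξ)
    (A : Finset V) (R : ℕ) (hR : 2 * ξ + 1 ≤ (R : ℝ)) :
    |√(S.fisher A β) - √(QLattice.variance (S.state β) (S.localHam A))| ≤
      2 * S.J * √(2 * M * S.N * S.Nbd) * (ξ + 1) ^ 2 * √((S.collar A R).card : ℝ)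
      + 40 * S.J * M * (A.card : ℝ) * √(S.Nbd : ℝ) * (ξ + 1) ^ (3 / 2 : ℝ)
          * (R : ℝ) ^ 2 * Real.exp (-(R : ℝ) / (2 * ξ)) := by
  have hξ0 := hξ.1
  have hM0 := hM.1
  have hJ := J_nonneg (S := S)
  have hω := posDef_state S β
  have hω1 := trace_state S β
  have hρ : (S.reduced A β).PosDef := posDef_partialTrace A hω
  have hρ1 : (S.reduced A β).trace = 1 := by
    rw [System.reduced, trace_partialTrace, hω1]
  have hCE : S.collar A R ⊆ S.edges := by
    classical
    exact (Finset.filter_subset _ _).trans Finset.sdiff_subset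
  have hFE : S.farEdges A R ⊆ S.edges := by
    classical
    exact (Finset.filter_subset _ _).trans Finset.sdiff_subset
  have hfar : ∀ Y ∈ S.farEdges A R, (R : ℕ∞) ≤ distSet S.edges A Y := by
    classical
    intro Y hY
    have := (Finset.mem_filter.1 hY).2
    rw [distSet_comm]
    exact not_lt.1 this
  -- the hypothesis on `R` forces `R ≥ 1`, so that far edges do not meet `A`
  have hdisj : ∀ Y ∈ S.farEdges A R, Disjoint A Y := by
    intro Y hY
    by_contra h
    have h1 := hfar Y hY
    rw [distSet_eq_zero _ h] at h1
    have h2 : R = 0 := by exact_mod_cast le_antisymm h1 bot_le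
    rw [h2] at hR
    norm_num at hR
    linarith
  obtain ⟨T, hT, hTA⟩ := S.exists_localHam_eq_extend A
  obtain ⟨LC, hLC, hLCs, hLCn⟩ := exists_reduced_sld (A := A) hω
    (isHermitian_centered hω.isHermitian (isHermitian_partialHam hCE))
  have hsld : ∀ Y : Finset V, ∃ L, Y ∈ S.farEdges A R → _ := fun Y => by
    by_cases hY : Y ∈ S.farEdges A R
    · obtain ⟨L, hL⟩ := hξ.exists_sld_term (hFE hY) (hdisj Y hY)
      exact ⟨L, fun _ => hL⟩
    · exact ⟨0, fun h => absurd h hY⟩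
  choose LF hLF using hsld
  set D := centered (S.reduced A β) T with hD
  have hDh : D.IsHermitian := isHermitian_centered hρ.isHermitian hT
  have hDs : symMul (S.reduced A β) D =
      partialTrace A (symMul (S.state β) (centered (S.state β) (S.localHam A))) := by
    have : centered (S.state β) (S.localHam A) = extend A D := by
      rw [hD, hTA, centered, centered, expect_extend, sub_eq_add_neg, sub_eq_add_neg, ← neg_smul,
        ← neg_smul, extend_add, extend_smul, extend_one]
      rfl
    rw [this, symMul_extend]
    rfl
  have hDvar : (expect (S.reduced A β) (D * D)).re = variance (S.state β) (S.localHam A) := by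
    rw [hD, re_expect_centered_mul_self hρ1, hTA, variance, variance, ← extend_mul, expect_extend,
      expect_extend]
    rfl
  -- `-L` is the symmetric logarithmic derivative of the reduced state
  set L := D + LC + ∑ Y ∈ S.farEdges A R, LF Y with hL
  have hLh : L.IsHermitian := by
    refine (hDh.add hLC).add ?_
    unfold Matrix.IsHermitian
    rw [conjTranspose_sum]
    exact Finset.sum_congr rfl fun Y hY => (hLF Y hY).1
  have hder : S.reducedDeriv A β = symMul (S.reduced A β) (-L) := by
    rw [S.reducedDeriv_eq, ← neg_one_smul ℂ L, symMul_smul, neg_one_smul, S.ham_eq_add A R,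
      centered_add, centered_add, symMul_add, symMul_add, partialTrace_add, partialTrace_add,
      hL, symMul_add, symMul_add, hDs, symMul_sum]
    congr 2
    · rw [← hLCs]; rfl
    · rw [System.partialHam, centered_sum, symMul_sum, partialTrace_sum]
      exact Finset.sum_congr rfl fun Y hY => (hLF Y hY).2.1.symm
  obtain ⟨Φ, hΦ, -⟩ := exists_gns hρ.posSemidef
  have hsq : ∀ X : Matrix (∀ x : {x // x ∈ A}, ι x) (∀ x : {x // x ∈ A}, ι x) ℂ,
      X.IsHermitian → √(expect (S.reduced A β) (X * X)).re = ‖Φ X‖ := by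
    intro X hX
    have h1 := hΦ X X
    rw [hX.eq, inner_self_eq_norm_sq_to_K] at h1
    have h2 : (expect (S.reduced A β) (X * X)).re = ‖Φ X‖ ^ 2 := by
      rw [← h1]
      norm_cast
    rw [h2, Real.sqrt_sq (norm_nonneg _)]
  have hfisher : √(S.fisher A β) = ‖Φ L‖ := by
    rw [System.fisher, hder, buresNormSq_symMul hρ _ hLh.neg, hsq _ hLh.neg, map_neg, norm_neg]
  rw [hfisher, ← hDvar, hsq D hDh]
  have hC : ‖Φ LC‖ ≤
      2 * S.J * √(2 * M * S.N * S.Nbd) * (ξ + 1) ^ 2 * √((S.collar A R).card : ℝ) := by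
    rw [← hsq LC hLC]
    rw [re_expect_centered_mul_self hω1] at hLCn
    refine (Real.sqrt_le_sqrt (hLCn.trans (variance_partialHam_le hξ hN hM hCE))).trans
      (le_of_eq ?_)
    have : 8 * S.J ^ 2 * M * S.N * S.Nbd * (ξ + 1) ^ 4 * ((S.collar A R).card : ℝ) =
        (2 * S.J * (ξ + 1) ^ 2) ^ 2 * ((2 * M * S.N * S.Nbd) * (S.collar A R).card) := by ring
    rw [this, Real.sqrt_mul (by positivity), Real.sqrt_sq (by positivity),
      Real.sqrt_mul (by positivity)]
    ring
  have hF : ∑ Y ∈ S.farEdges A R, ‖Φ (LF Y)‖ ≤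
      40 * S.J * M * (A.card : ℝ) * √(S.Nbd : ℝ) * (ξ + 1) ^ (3 / 2 : ℝ)
          * (R : ℝ) ^ 2 * Real.exp (-(R : ℝ) / (2 * ξ)) := by
    have hpow : (ξ + 1) ^ (3 / 2 : ℝ) = (ξ + 1) * √(ξ + 1) := by
      rw [Real.sqrt_eq_rpow, ← Real.rpow_one_add' (by linarith) (by norm_num)]
      norm_num
    calc ∑ Y ∈ S.farEdges A R, ‖Φ (LF Y)‖
        ≤ ∑ Y ∈ S.farEdges A R,
            2 * S.J * √(S.Nbd : ℝ) * √(ξ + 1) * decay (2 * ξ) (distSet S.edges A Y) := by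
          refine Finset.sum_le_sum fun Y hY => ?_
          rw [← hsq _ (hLF Y hY).1]
          exact (hLF Y hY).2.2
      _ ≤ 2 * S.J * √(S.Nbd : ℝ) * √(ξ + 1) *
            (A.card * (M * (Real.exp (-(R : ℝ) / (2 * ξ)) * (10 * (R : ℝ) ^ 2 * (ξ + 1))))) := by
          rw [← Finset.mul_sum]
          exact mul_le_mul_of_nonneg_left (hM.sum_decay_far_le hξ0 A hFE hR hfar) (by positivity)
      _ = 20 * (S.J * M * (A.card : ℝ) * √(S.Nbd : ℝ) * (ξ + 1) ^ (3 / 2 : ℝ)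
          * (R : ℝ) ^ 2 * Real.exp (-(R : ℝ) / (2 * ξ))) := by
          rw [hpow]
          ring
      _ ≤ 40 * (S.J * M * (A.card : ℝ) * √(S.Nbd : ℝ) * (ξ + 1) ^ (3 / 2 : ℝ)
          * (R : ℝ) ^ 2 * Real.exp (-(R : ℝ) / (2 * ξ))) :=
          mul_le_mul_of_nonneg_right (by norm_num) (by positivity)
      _ = _ := by ring
  refine (abs_norm_sub_norm_le _ _).trans ?_
  have : Φ L - Φ D = Φ LC + ∑ Y ∈ S.farEdges A R, Φ (LF Y) := by
    rw [hL, map_add, map_add, map_sum]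
    abel
  rw [this]
  exact (norm_add_le _ _).trans (add_le_add hC ((norm_sum_le _ _).trans hF))
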